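/- **Setting.** An episodic MDP has a finite state space $\mathcal S$ ($S=|\mathcal S|\ge 1$), a finite action space $\mathcal A$ ($A=|\mathcal A|\ge1$), $H\ge1$ steps, transition kernels $P_h(\cdot\mid s,a)$ and known deterministic rewards $r_h(s,a)\in[0,1]$, $h\in[H]$. For $\beta\ne0$ the entropic risk measure is $U_\beta(F)=\frac1\beta\log\int e^{\beta x}\,dF(x)$. For a deterministic Markov policy $\pi$, $V^\pi_1(s)$ is $U_\beta$ of the law of the return $\sum_{h=1}^H r_h(s_h,a_h)$ when $\pi$ is followed from $s_1=s$, and $V_1^*(s)=\max_\pi V_1^\pi(s)$. An algorithm interacts with the MDP for $K\ge1$ episodes ($T=KH$): in episode $k$ it computes a policy $\pi^k$ from the record of the previous episodes, Nature selects the initial state $s^k_1$ arbitrarily (adaptively, possibly at random), and $\pi^k$ is followed. Its regret is $\mathrm{Regret}(K)=\sum_{k=1}^K\big(V^*_1(s^k_1)-V^{\pi^k}_1(s^k_1)\big)$. Let $N^k_h(s,a)$ be the number of visits of $(s,a)$ at step $h$ in the first $k-1$ episodes, $\hat P^k_h(\cdot\mid s,a)$ the empirical transition probabilities (uniform if $N^k_h(s,a)=0$),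 $c^k_h(s,a)=\sqrt{2S\iota/\max(N^k_h(s,a),1)}$, and let $B_1(Q,c)$ be the set of probability mass functions on $\mathcal S$ at $\ell_1$ distance at most $c$ from $Q$. Here $\iota$ is any number with $\log(SAT/\delta)\le\iota\le\log(4SAT/\delta)$. **RODI-MB.** In episode $k$, put $\nu^k_{H+1}(s)=\delta_0$ (Dirac at $0$) and, for $h=H,\dots,1$: if $N^k_h(s,a)>0$, let $\tilde P\in\arg\max_{P\in B_1(\hat P^k_h(\cdot\mid s,a),\,c^k_h(s,a))}U_\beta\big(\sum_{s'}P(s')\nu^k_{h+1}(s')\big)$ and let $\eta^k_h(s,a)$ be $\sum_{s'}\tilde P(s')\nu^k_{h+1}(s')$ shifted by $r_h(s,a)$; otherwise $\eta^k_h(s,a)$ is the Dirac measure at $H+1-h$. Then $\pi^k_h(s)\in\arg\max_aU_\beta(\eta^k_h(s,a))$ and $\nu^k_h(s)=\eta^k_h(s,\pi^k_h(s))$. **ROVI.** In episode $k$, put $W^k_{H+1}=1$ and, for $h=H,\dots,1$: if $N^k_h(s,a)>0$, let $\tilde P\in\arg\max_{P\in B_1(\hat P^k_h(\cdot\mid s,a),\,c^k_h(s,a))}\operatorname{sign}(\beta)\sum_{s'}P(s')W^k_{h+1}(s')$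 and $J^k_h(s,a)=e^{\beta r_h(s,a)}\sum_{s'}\tilde P(s')W^k_{h+1}(s')$; otherwise $J^k_h(s,a)=e^{\beta(H+1-h)}$. Then $\pi^k_h(s)\in\arg\max_a\operatorname{sign}(\beta)J^k_h(s,a)$ and $W^k_h(s)=J^k_h(s,\pi^k_h(s))$. **Theorem.** If the two algorithms select from their $\arg\max$ sets by the same (arbitrary) rule, then for every record of past episodes they compute the same policy; hence they have the same regret. Moreover there is an absolute constant $C>0$ such that for every such MDP, all $K\ge1$, $\beta\neq0$, $\delta\in(0,1)$, every selection rule and every choice of the initial states by Nature, with probability at least $1-\delta$, $$\mathrm{Regret}(\text{RODI-MB},K)=\mathrm{Regret}(\text{ROVI},K)\le C\,L_H\,H\sqrt{S^2AK\log(4SAT/\delta)},\qquad L_H=\frac{\exp(|\beta|H)-1}{|\beta|},$$ that is, the regret is $\tilde{\mathcal O}\big(\frac{\exp(|\beta|H)-1}{|\beta|}H\sqrt{S^2AK}\big)$. -/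

import Mathlib

namespace RiskRL

noncomputable section

/-! ## Entropic risk measure and episodic Markov decision processes

Steps are numbered `0, 1, …, H - 1`, so that step `h` here is step `h + 1` in the usual
one-based numbering, and there are `H - h` rewards still to be collected at step `h`. -/

/-- The entropic risk measure `U_β(F) = (1/β) log ∫ exp (β x) dF(x)` of a law on the line. -/
def entRM (β : ℝ) (F : MeasureTheory.Measure ℝ) : ℝ :=
  Real.log (∫ x, Real.exp (β * x) ∂F) / β

/-- An episodic MDP with `H` steps: transition kernels `P h` and rewards `r h` in `[0, 1]`.
Only the values at `h < H` are ever used. -/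
structure EpisodicMDP (S A : Type*) (H : ℕ) where
  P : ℕ → S → A → PMF S
  r : ℕ → S → A → ℝ
  r_mem : ∀ h < H, ∀ s a, r h s a ∈ Set.Icc (0 : ℝ) 1

/-- Deterministic Markov policies: `π h s` is the action taken at step `h` in state `s`. -/
abbrev Policy (S A : Type*) := ℕ → S → A

/-- The record of one episode: the initial state, and the list of the
transitions `(s_h, a_h, s_{h+1})` in the order of the steps. -/
abbrev Episode (S A : Type*) := S × List (S × A × S)

/-- The record of the past episodes, the most recent episode first. -/
abbrev History (S A : Type*) := List (Episode S A)

/-- A learning algorithm maps the record of the past episodes to the policy of the next one. -/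
abbrev Algorithm (S A : Type*) := History S A → Policy S A

variable {S A : Type*}

/-- The law of the next `n` transitions when policy `π` is followed from state `s` at step `h`. -/
def rollout {H : ℕ} (M : EpisodicMDP S A H) (π : Policy S A) :
    ℕ → ℕ → S → PMF (List (S × A × S))
  | 0, _, _ => PMF.pure []
  | n + 1, h, s => (M.P h s (π h s)).bind fun s' =>
      (rollout M π n (h + 1) s').map fun l => (s, π h s, s') :: l

/-- The sum of the rewards along a list of transitions that starts at step `h`. -/
def totalReward (r : ℕ → S → A → ℝ) : ℕ → List (S × A × S) → ℝ
  | _, [] => 0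
  | h, (s, a, _) :: l => r h s a + totalReward r (h + 1) l

/-- The value `V^π_1(s)`: the entropic risk of the return of `π` in an episode started at `s`. -/
def value {H : ℕ} (M : EpisodicMDP S A H) (β : ℝ) (π : Policy S A) (s : S) : ℝ :=
  entRM β ((rollout M π H 0 s).map (totalReward M.r 0)).toMeasure

/-- The optimal value `V^*_1(s)`. -/
def optValue {H : ℕ} (M : EpisodicMDP S A H) (β : ℝ) (s : S) : ℝ :=
  ⨆ π : Policy S A, value M β π s

/-- The law of the record of the first `k` episodes when the algorithm `alg` interacts with `M`;
the initial state of each episode is selected by Nature, adaptively and possibly at random. -/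
def historyLaw {H : ℕ} (M : EpisodicMDP S A H) (init : History S A → PMF S)
    (alg : Algorithm S A) : ℕ → PMF (History S A)
  | 0 => PMF.pure []
  | k + 1 => (historyLaw M init alg k).bind fun F => (init F).bind fun s =>
      (rollout M (alg F) H 0 s).map fun e => (s, e) :: F

/-- The regret `∑ₖ (V^*_1(s^k_1) - V^{π^k}_1(s^k_1))`, `π^k = alg F_k`, as a function of the
record of the episodes. -/
def regret {H : ℕ} (M : EpisodicMDP S A H) (β : ℝ) (alg : Algorithm S A) : History S A → ℝ
  | [] => 0
  | e :: F => (optValue M β e.1 - value M β (alg F) e.1) + regret M β alg F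

/-! ## Ingredients of the algorithms -/

/-- The set of maximizers of `f` on `X`. -/
def argmaxOn {α : Type*} (X : Set α) (f : α → ℝ) : Set α :=
  {x | x ∈ X ∧ ∀ y ∈ X, f y ≤ f x}

/-- A rule by which an algorithm selects one element of each `argmax` that it meets; the rule for
the actions may depend on the step and the state, the rule for the models on the step, the state
and the action. -/
structure TieBreak (S A : Type*) where
  act : ℕ → S → Set A → A
  act_mem : ∀ h s X, X.Nonempty → act h s X ∈ X
  model : ℕ → S → A → Set (S → ℝ) → (S → ℝ)
  model_mem : ∀ h s a X, X.Nonempty → model h s a X ∈ X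

variable [Fintype S]

/-- The probability mass functions in the `ℓ¹` ball `B₁(Q, c)`. -/
def l1Ball (Q : S → ℝ) (c : ℝ) : Set (S → ℝ) :=
  {P | P ∈ stdSimplex ℝ S ∧ ∑ s, |P s - Q s| ≤ c}

/-- The mixture `[P ν] = ∑ s', P(s') ν(s')`. -/
def mixture (P : S → ℝ) (ν : S → MeasureTheory.Measure ℝ) : MeasureTheory.Measure ℝ :=
  ∑ s, ENNReal.ofReal (P s) • ν s

variable [DecidableEq S] [DecidableEq A]

/-- The number of past visits of `(s, a)` at step `h` that were followed by the state `s'`. -/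
def transCount (F : History S A) (h : ℕ) (s : S) (a : A) (s' : S) : ℕ :=
  F.countP fun e => e.2[h]? = some (s, a, s')

/-- The number `N_h(s, a)` of past visits of `(s, a)` at step `h`. -/
def visitCount (F : History S A) (h : ℕ) (s : S) (a : A) : ℕ :=
  ∑ s', transCount F h s a s'

/-- The empirical transition model `P̂_h(· | s, a)`, uniform for unvisited pairs. -/
def empModel (F : History S A) (h : ℕ) (s : S) (a : A) (s' : S) : ℝ :=
  if 0 < visitCount F h s a then (transCount F h s a s' : ℝ) / visitCount F h s a
  else 1 / Fintype.card S

/-- The optimism constant `c_h(s, a) = √(2 S ι / max(N_h(s, a), 1))`. -/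
def optRadius (ι : ℝ) (F : History S A) (h : ℕ) (s : S) (a : A) : ℝ :=
  Real.sqrt (2 * Fintype.card S * ι / max (visitCount F h s a : ℝ) 1)

/-! ## RODI-MB -/

/-- The distributional optimism operator `argmax {U_β([P ν]) | P ∈ B₁(Q, c)}` (all maximizers). -/
def distOptimism (β : ℝ) (Q : S → ℝ) (c : ℝ) (ν : S → MeasureTheory.Measure ℝ) : Set (S → ℝ) :=
  argmaxOn (l1Ball Q c) fun P => entRM β (mixture P ν)

/-- The optimistic return law `η_h(s, a)` computed from the laws `ν = ν_{h+1}`. -/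
def rodiEta (H : ℕ) (r : ℕ → S → A → ℝ) (β ι : ℝ) (tb : TieBreak S A) (F : History S A)
    (ν : S → MeasureTheory.Measure ℝ) (h : ℕ) (s : S) (a : A) : MeasureTheory.Measure ℝ :=
  if 0 < visitCount F h s a then
    (mixture (tb.model h s a
      (distOptimism β (empModel F h s a) (optRadius ι F h s a) ν)) ν).map (fun x => x + r h s a)
  else MeasureTheory.Measure.dirac ((H : ℝ) - h)

/-- A greedy action for `U_β(η_h(s, ·))`. -/
def rodiAct (H : ℕ) (r : ℕ → S → A → ℝ) (β ι : ℝ) (tb : TieBreak S A) (F : History S A)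
    (ν : S → MeasureTheory.Measure ℝ) (h : ℕ) (s : S) : A :=
  tb.act h s (argmaxOn Set.univ fun a => entRM β (rodiEta H r β ι tb F ν h s a))

/-- The backward recursion of RODI-MB: `rodiNu … n` is `ν_h` at the step `h = H - n`. -/
def rodiNu (H : ℕ) (r : ℕ → S → A → ℝ) (β ι : ℝ) (tb : TieBreak S A) (F : History S A) :
    ℕ → S → MeasureTheory.Measure ℝ
  | 0 => fun _ => MeasureTheory.Measure.dirac 0
  | n + 1 => fun s =>
      rodiEta H r β ι tb F (rodiNu H r β ι tb F n) (H - (n + 1)) s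
        (rodiAct H r β ι tb F (rodiNu H r β ι tb F n) (H - (n + 1)) s)

/-- The algorithm RODI-MB. -/
def rodiMB (H : ℕ) (r : ℕ → S → A → ℝ) (β ι : ℝ) (tie : History S A → TieBreak S A) :
    Algorithm S A := fun F h s =>
  rodiAct H r β ι (tie F) F (rodiNu H r β ι (tie F) F (H - (h + 1))) h s

/-! ## ROVI -/

/-- The optimism operator on values: all maximizers of `sign(β) ∑ s', P(s') W(s')` over
`P ∈ B₁(Q, c)`. -/
def valueOptimism (β : ℝ) (Q : S → ℝ) (c : ℝ) (W : S → ℝ) : Set (S → ℝ) :=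
  argmaxOn (l1Ball Q c) fun P => Real.sign β * ∑ s, P s * W s

/-- The optimistic exponential value `J_h(s, a)` computed from the values `W = W_{h+1}`. -/
def roviJ (H : ℕ) (r : ℕ → S → A → ℝ) (β ι : ℝ) (tb : TieBreak S A) (F : History S A)
    (W : S → ℝ) (h : ℕ) (s : S) (a : A) : ℝ :=
  if 0 < visitCount F h s a then
    Real.exp (β * r h s a) * ∑ s', tb.model h s a
      (valueOptimism β (empModel F h s a) (optRadius ι F h s a) W) s' * W s'
  else Real.exp (β * ((H : ℝ) - h))

/-- A greedy action for `sign(β) J_h(s, ·)`. -/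
def roviAct (H : ℕ) (r : ℕ → S → A → ℝ) (β ι : ℝ) (tb : TieBreak S A) (F : History S A)
    (W : S → ℝ) (h : ℕ) (s : S) : A :=
  tb.act h s (argmaxOn Set.univ fun a => Real.sign β * roviJ H r β ι tb F W h s a)

/-- The backward recursion of ROVI: `roviW … n` is `W_h` at the step `h = H - n`. The value is
`J_h` at the greedy action, that is `max_a J_h(s, a)` for `β > 0`, `min_a J_h(s, a)` for `β < 0`. -/
def roviW (H : ℕ) (r : ℕ → S → A → ℝ) (β ι : ℝ) (tb : TieBreak S A) (F : History S A) :
    ℕ → S → ℝ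
  | 0 => fun _ => 1
  | n + 1 => fun s =>
      roviJ H r β ι tb F (roviW H r β ι tb F n) (H - (n + 1)) s
        (roviAct H r β ι tb F (roviW H r β ι tb F n) (H - (n + 1)) s)

/-- The algorithm ROVI. -/
def rovi (H : ℕ) (r : ℕ → S → A → ℝ) (β ι : ℝ) (tie : History S A → TieBreak S A) :
    Algorithm S A := fun F h s =>
  roviAct H r β ι (tie F) F (roviW H r β ι (tie F) F (H - (h + 1))) h s

/-- The constant `L_M = (exp(|β| M) - 1) / |β|`, the Lipschitz constant of `U_β` with respect to
the supremum distance of distribution functions on `[0, M]`. -/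
def lipConst (β M : ℝ) : ℝ := (Real.exp (|β| * M) - 1) / |β|

end

end RiskRL

/-! Equivalence. `U_β` depends on a law only through its exponential moment `w`, as `log w / β`, and
this is increasing in `sign β * w`. Mixtures and shifts act on exponential moments exactly as ROVI
acts on its values, so by backward induction `roviW` gives the moments of `rodiNu`. The two
algorithms thus meet identical argmax sets, and a common selection rule returns the same policy
(`rodiMB_eq_rovi`).

Regret of one episode. If every true kernel lies in its confidence ball, the values of ROVI are
optimistic in the order given by `sign β` (`sign_mul_expValue_le_roviW`). Their excess over the
values of the executed policy is at most the width of the range of exponential values times the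
expected sum of bonuses, truncated at 1 (`sign_mul_roviW_sub_le`). Induction closes because the
factor `exp (β r)` is absorbed by the growth of the width. Taking the logarithm once, at the first
step, turns the width into `L_H`.

Probability. Both high-probability events come from Ville's inequality. Exponential supermartingales
for the visits of subsets of `S`, with a union bound, give the confidence balls
(`toOuterMeasure_not_concentrated_le_half`). A second supermartingale (`drift`) bounds the sum of
expected bonuses by twice the sum of observed ones plus `2 H log (2/δ)`; being multiplicative, this
comparison costs no term of order `√K`.

Summation. Observed bonuses are dominated by increments of `∑ √N`, which telescope, and
Cauchy–Schwarz bounds the final potential by `H √(S A K)`. When `K` is at most a multiple of the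
logarithm, the trivial bound `K H` suffices. -/

open scoped ENNReal

namespace RiskRL

/-! ## Expectations under a probability mass function -/

/-- The expectation of an extended nonnegative function under a probability mass function. -/
noncomputable def expect {α : Type*} (p : PMF α) (f : α → ℝ≥0∞) : ℝ≥0∞ := ∑' x, p x * f x

section Expect

variable {α β : Type*}

theorem expect_mono {p : PMF α} {f g : α → ℝ≥0∞} (h : ∀ x, f x ≤ g x) :
    expect p f ≤ expect p g :=
  ENNReal.tsum_le_tsum fun x => by gcongr; exact h x

theorem expect_const (p : PMF α) (c : ℝ≥0∞) : expect p (fun _ => c) = c := by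
  simp [expect, ENNReal.tsum_mul_right]

theorem expect_le_of_forall_le {p : PMF α} {f : α → ℝ≥0∞} {c : ℝ≥0∞} (h : ∀ x, f x ≤ c) :
    expect p f ≤ c :=
  (expect_mono h).trans_eq (expect_const p c)

theorem expect_const_mul (p : PMF α) (c : ℝ≥0∞) (f : α → ℝ≥0∞) :
    expect p (fun x => c * f x) = c * expect p f := by
  simp only [expect, ← ENNReal.tsum_mul_left]
  exact tsum_congr fun x => by ring

theorem expect_pure (a : α) (f : α → ℝ≥0∞) : expect (PMF.pure a) f = f a := by
  rw [expect, tsum_eq_single a]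
  · simp
  · intro b hb
    simp [PMF.pure_apply_of_ne _ _ hb]

theorem expect_bind (p : PMF α) (q : α → PMF β) (f : β → ℝ≥0∞) :
    expect (p.bind q) f = expect p fun a => expect (q a) f := by
  simp only [expect, PMF.bind_apply, ← ENNReal.tsum_mul_right, ← ENNReal.tsum_mul_left]
  rw [ENNReal.tsum_comm]
  exact tsum_congr fun a => tsum_congr fun b => by ring

theorem expect_map (p : PMF α) (g : α → β) (f : β → ℝ≥0∞) :
    expect (p.map g) f = expect p fun a => f (g a) := by
  rw [PMF.map, expect_bind]
  simp [expect_pure]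

theorem expect_fintype [Fintype α] (p : PMF α) (f : α → ℝ≥0∞) :
    expect p f = ∑ x, p x * f x := by
  rw [expect, tsum_fintype]

theorem sum_toReal_eq_one [Fintype α] (p : PMF α) : ∑ x, (p x).toReal = 1 := by
  rw [← ENNReal.toReal_sum fun x _ => p.apply_ne_top x, ← tsum_fintype (L := SummationFilter.unconditional _), p.tsum_coe,
    ENNReal.toReal_one]

theorem toReal_mem_stdSimplex [Fintype α] (p : PMF α) :
    (fun x => (p x).toReal) ∈ stdSimplex ℝ α :=
  ⟨fun _ => ENNReal.toReal_nonneg, sum_toReal_eq_one p⟩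

theorem expect_ofReal [Fintype α] (p : PMF α) {f : α → ℝ} (hf : ∀ x, 0 ≤ f x) :
    expect p (fun x => ENNReal.ofReal (f x)) = ENNReal.ofReal (∑ x, (p x).toReal * f x) := by
  rw [expect_fintype, ENNReal.ofReal_sum_of_nonneg
    fun x _ => mul_nonneg ENNReal.toReal_nonneg (hf x)]
  refine Finset.sum_congr rfl fun x _ => ?_
  rw [ENNReal.ofReal_mul ENNReal.toReal_nonneg, ENNReal.ofReal_toReal (p.apply_ne_top x)]

/-- The measure is a sum of weighted Dirac masses. This links `entRM`, defined by an integral on the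
line, to the sums used in the rest of the proof. -/
theorem lintegral_toMeasure [MeasurableSpace α] (p : PMF α) {f : α → ℝ≥0∞} (hf : Measurable f) :
    ∫⁻ x, f x ∂p.toMeasure = expect p f := by
  have h : p.toMeasure = MeasureTheory.Measure.sum
      fun x => p x • MeasureTheory.Measure.dirac x := by
    ext s hs
    rw [p.toMeasure_apply hs, MeasureTheory.Measure.sum_apply _ hs]
    refine tsum_congr fun x => ?_
    by_cases hx : x ∈ s <;> simp [hs, hx]
  rw [h, MeasureTheory.lintegral_sum_measure]
  exact tsum_congr fun x => by
    rw [MeasureTheory.lintegral_smul_measure, MeasureTheory.lintegral_dirac' _ hf, smul_eq_mul]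

theorem toOuterMeasure_eq_expect (p : PMF α) (s : Set α) :
    p.toOuterMeasure s = expect p (s.indicator fun _ => 1) := by
  rw [PMF.toOuterMeasure_apply, expect]
  exact tsum_congr fun x => by by_cases hx : x ∈ s <;> simp [hx]

theorem mul_toOuterMeasure_le_expect (p : PMF α) (c : ℝ≥0∞) (f : α → ℝ≥0∞) :
    c * p.toOuterMeasure {x | c ≤ f x} ≤ expect p f := by
  rw [toOuterMeasure_eq_expect, ← expect_const_mul]
  refine expect_mono fun x => ?_
  by_cases hx : c ≤ f x <;> simp [hx]

theorem toOuterMeasure_compl_add (p : PMF α) (s : Set α) :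
    p.toOuterMeasure s + p.toOuterMeasure sᶜ = 1 := by
  simp only [PMF.toOuterMeasure_apply, ← ENNReal.tsum_add]
  rw [← p.tsum_coe]
  exact tsum_congr fun x => by by_cases hx : x ∈ s <;> simp [hx]

theorem ofReal_one_sub_le_toOuterMeasure (p : PMF α) {s : Set α} {δ : ℝ} (hδ : 0 ≤ δ)
    (h : p.toOuterMeasure sᶜ ≤ ENNReal.ofReal δ) :
    ENNReal.ofReal (1 - δ) ≤ p.toOuterMeasure s := by
  rw [ENNReal.ofReal_sub _ hδ, ENNReal.ofReal_one, ← toOuterMeasure_compl_add p s]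
  exact tsub_le_iff_right.2 (by gcongr)

end Expect

/-! ## Supermartingales along the record of the episodes -/

section Ville

variable {S A : Type*} {H : ℕ} {M : EpisodicMDP S A H} {init : History S A → PMF S}
  {alg : Algorithm S A}

theorem length_eq_of_mem_support_historyLaw {k : ℕ} {F : History S A}
    (hF : F ∈ (historyLaw M init alg k).support) : F.length = k := by
  induction k generalizing F with
  | zero => simp [historyLaw] at hF; simp [hF]
  | succ k ih =>
    simp only [historyLaw, PMF.mem_support_bind_iff, PMF.mem_support_map_iff] at hF
    obtain ⟨F', hF', s, -, e, -, rfl⟩ := hF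
    simp [ih hF']

/-- The law charges only records of `k` episodes, so the length may be assumed when events are
compared. -/
theorem toOuterMeasure_historyLaw_mono {k : ℕ} {X Y : Set (History S A)}
    (h : ∀ F ∈ X, F.length = k → F ∈ Y) :
    (historyLaw M init alg k).toOuterMeasure X ≤ (historyLaw M init alg k).toOuterMeasure Y :=
  PMF.toOuterMeasure_mono _ fun F hF => h F hF.1 (length_eq_of_mem_support_historyLaw hF.2)

/-- The process `Φ` stopped when it reaches the level `c`. -/
noncomputable def stopped (Φ : History S A → ℝ≥0∞) (c : ℝ≥0∞) : History S A → ℝ≥0∞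
  | [] => Φ []
  | e :: F => by
    classical exact if c ≤ stopped Φ c F then stopped Φ c F else Φ (e :: F)

theorem stopped_eq_of_lt {Φ : History S A → ℝ≥0∞} {c : ℝ≥0∞} {F : History S A}
    (h : ¬ c ≤ stopped Φ c F) : stopped Φ c F = Φ F := by
  cases F with
  | nil => rfl
  | cons e F =>
    simp only [stopped] at h ⊢
    split_ifs at h ⊢ with h' <;> trivial

/-- Records grow at the head, so earlier records are suffixes. A frozen value stays above the level,
hence the present value of the stopped process remembers any past crossing. -/
theorem le_stopped {Φ : History S A → ℝ≥0∞} {c : ℝ≥0∞} {F F' : History S A}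
    (hF : F' <:+ F) (h : c ≤ Φ F') : c ≤ stopped Φ c F := by
  induction F with
  | nil => rw [List.suffix_nil] at hF; subst hF; exact h
  | cons e F ih =>
    rw [stopped]
    split_ifs with h'
    · exact h'
    · rcases List.suffix_cons_iff.1 hF with rfl | hF
      · exact h
      · exact absurd (ih hF) h'

/-- **Ville's inequality** for a supermartingale along the record of the episodes. -/
theorem ville_inequality {Φ : History S A → ℝ≥0∞}
    (hΦ : ∀ F s, expect (rollout M (alg F) H 0 s) (fun e => Φ ((s, e) :: F)) ≤ Φ F)
    (c : ℝ≥0∞) (k : ℕ) :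
    c * (historyLaw M init alg k).toOuterMeasure {F | ∃ F', F' <:+ F ∧ c ≤ Φ F'} ≤ Φ [] := by
  -- Stopping preserves the supermartingale property; Markov's inequality at the single time `k`
  -- then controls all earlier times.
  have key : ∀ k, expect (historyLaw M init alg k) (stopped Φ c) ≤ Φ [] := by
    intro k
    induction k with
    | zero => simp [historyLaw, expect_pure, stopped]
    | succ k ih =>
      refine le_trans ?_ ih
      simp only [historyLaw, expect_bind, expect_map]
      refine expect_mono fun F => expect_le_of_forall_le fun s => ?_
      by_cases h : c ≤ stopped Φ c F
      · simp [stopped, h, expect_const]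
      · simp only [stopped, h, if_false]
        exact (hΦ F s).trans_eq (stopped_eq_of_lt h).symm
  refine le_trans ?_ ((mul_toOuterMeasure_le_expect _ c (stopped Φ c)).trans (key k))
  gcongr
  rintro ⟨F', h1, h2⟩
  exact le_stopped h1 h2

end Ville

/-- An episode contributes at most one transition at a given step. Conditioning on the state reached
there reduces the claim to one draw from the kernel, whatever the policy. -/
theorem expect_rollout_getElem_le_one {S A : Type*} {H : ℕ} (M : EpisodicMDP S A H)
    (π : Policy S A) {g : Option (S × A × S) → ℝ≥0∞} {i : ℕ}
    (h0 : g none ≤ 1) (n h : ℕ) (s : S)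
    (hg : ∀ s a, expect (M.P (h + i) s a) (fun s' => g (some (s, a, s'))) ≤ 1) :
    expect (rollout M π n h s) (fun l => g l[i]?) ≤ 1 := by
  induction n generalizing h i s with
  | zero => simpa [rollout, expect_pure] using h0
  | succ n ih =>
    simp only [rollout, expect_bind, expect_map]
    cases i with
    | zero => simpa [expect_const] using hg s (π h s)
    | succ i =>
      refine expect_le_of_forall_le fun s' => ?_
      simpa using ih (i := i) (h + 1) s' (by simpa [add_assoc, add_comm 1 i] using hg)

/-! ## Exponential values -/

section ExpValue

variable {S A : Type*} [Fintype S] {H : ℕ}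

/-- The exponential value `E exp (β G)` of the return `G` of `π` over the next `n` steps. -/
noncomputable def expValue (M : EpisodicMDP S A H) (β : ℝ) (π : Policy S A) : ℕ → ℕ → S → ℝ
  | 0, _, _ => 1
  | n + 1, h, s => Real.exp (β * M.r h s (π h s)) *
      ∑ s', (M.P h s (π h s) s').toReal * expValue M β π n (h + 1) s'

/-- The expected sum of `u` over the next `n` steps. -/
noncomputable def sumValue (M : EpisodicMDP S A H) (u : ℕ → S → A → ℝ) (π : Policy S A) :
    ℕ → ℕ → S → ℝ
  | 0, _, _ => 0
  | n + 1, h, s => u h s (π h s) +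
      ∑ s', (M.P h s (π h s) s').toReal * sumValue M u π n (h + 1) s'

variable (M : EpisodicMDP S A H) (β : ℝ) (π : Policy S A)

theorem expValue_nonneg (n h : ℕ) (s : S) : 0 ≤ expValue M β π n h s := by
  induction n generalizing h s with
  | zero => simp [expValue]
  | succ n ih =>
    exact mul_nonneg (Real.exp_pos _).le
      (Finset.sum_nonneg fun s' _ => mul_nonneg ENNReal.toReal_nonneg (ih _ _))

theorem expect_rollout_exp (n h : ℕ) (s : S) :
    expect (rollout M π n h s) (fun l => ENNReal.ofReal (Real.exp (β * totalReward M.r h l))) =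
      ENNReal.ofReal (expValue M β π n h s) := by
  induction n generalizing h s with
  | zero => simp [rollout, expect_pure, totalReward, expValue]
  | succ n ih =>
    simp only [rollout, expect_bind, expect_map, totalReward, mul_add, Real.exp_add,
      ENNReal.ofReal_mul (Real.exp_pos _).le, expect_const_mul, ih, expValue]
    rw [expect_ofReal _ fun s' => expValue_nonneg M β π n (h + 1) s']

/-- The integrand is positive, so the integral can be read off from the lower integral without an
integrability proof. -/
theorem entRM_eq_of_lintegral {β : ℝ} {F : MeasureTheory.Measure ℝ} {w : ℝ} (hw : 0 ≤ w)
    (h : ∫⁻ x, ENNReal.ofReal (Real.exp (β * x)) ∂F = ENNReal.ofReal w) :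
    entRM β F = Real.log w / β := by
  rw [entRM, MeasureTheory.integral_eq_lintegral_of_nonneg_ae
    (Filter.Eventually.of_forall fun x => (Real.exp_pos _).le)
    (by fun_prop : Measurable fun x : ℝ => Real.exp (β * x)).aestronglyMeasurable, h,
    ENNReal.toReal_ofReal hw]

theorem value_eq (s : S) : value M β π s = Real.log (expValue M β π H 0 s) / β := by
  refine entRM_eq_of_lintegral (expValue_nonneg _ _ _ _ _ _) ?_
  rw [lintegral_toMeasure _ (by fun_prop), expect_map, expect_rollout_exp]

theorem sumValue_nonneg {u : ℕ → S → A → ℝ} (hu : ∀ h s a, 0 ≤ u h s a) (n h : ℕ) (s : S) :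
    0 ≤ sumValue M u π n h s := by
  induction n generalizing h s with
  | zero => simp [sumValue]
  | succ n ih =>
    exact add_nonneg (hu _ _ _)
      (Finset.sum_nonneg fun s' _ => mul_nonneg ENNReal.toReal_nonneg (ih _ _))

theorem sum_toReal_mul_le {p : PMF S} {f : S → ℝ} {c : ℝ} (h : ∀ s, f s ≤ c) :
    ∑ s, (p s).toReal * f s ≤ c := by
  calc ∑ s, (p s).toReal * f s ≤ ∑ s, (p s).toReal * c :=
        Finset.sum_le_sum fun s _ => mul_le_mul_of_nonneg_left (h s) ENNReal.toReal_nonneg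
    _ = c := by rw [← Finset.sum_mul, sum_toReal_eq_one, one_mul]

theorem sumValue_le {u : ℕ → S → A → ℝ} {m : ℝ} (hu : ∀ h s a, u h s a ≤ m) (n h : ℕ) (s : S) :
    sumValue M u π n h s ≤ n * m := by
  induction n generalizing h s with
  | zero => simp [sumValue]
  | succ n ih =>
    have h2 := sum_toReal_mul_le (p := M.P h s (π h s)) (ih (h + 1))
    have h1 := hu h s (π h s)
    simp only [sumValue]
    push_cast
    linarith

/-- Linearity of expectation for extended nonnegative functions: the constant `c` is large enough
that `ENNReal.ofReal` truncates nothing on the support. -/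
theorem expect_rollout_sub {u : ℕ → S → A → ℝ} {m : ℝ} (hu : ∀ h s a, u h s a ≤ m)
    (n h : ℕ) (s : S) {c : ℝ} (hc : n * m ≤ c) :
    expect (rollout M π n h s) (fun l => ENNReal.ofReal (c - totalReward u h l)) =
      ENNReal.ofReal (c - sumValue M u π n h s) := by
  induction n generalizing h s c with
  | zero => simp [rollout, expect_pure, totalReward, sumValue]
  | succ n ih =>
    have h1 := hu h s (π h s)
    push_cast at hc
    simp only [rollout, expect_bind, expect_map, totalReward, sumValue, ← sub_sub]
    simp only [fun s' => ih (h + 1) s' (c := c - u h s (π h s)) (by linarith)]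
    rw [expect_ofReal _ fun s' => ?_]
    · congr 1
      simp only [mul_sub, Finset.sum_sub_distrib, ← Finset.sum_mul, sum_toReal_eq_one, one_mul]
    · have := sumValue_le M π hu n (h + 1) s'
      linarith

end ExpValue

/-! ## RODI-MB and ROVI compute the same policy -/

section Equivalence

variable {α : Type*}

theorem argmaxOn_congr {X : Set α} {f g : α → ℝ}
    (h : ∀ x ∈ X, ∀ y ∈ X, (f y ≤ f x ↔ g y ≤ g x)) : argmaxOn X f = argmaxOn X g := by
  ext x
  exact ⟨fun hx => ⟨hx.1, fun y hy => (h x hx.1 y hy).1 (hx.2 y hy)⟩,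
    fun hx => ⟨hx.1, fun y hy => (h x hx.1 y hy).2 (hx.2 y hy)⟩⟩

theorem log_div_le_log_div_iff {β x y : ℝ} (hβ : β ≠ 0) (hx : 0 < x) (hy : 0 < y) :
    Real.log y / β ≤ Real.log x / β ↔ Real.sign β * y ≤ Real.sign β * x := by
  rcases hβ.lt_or_gt with h | h
  · rw [Real.sign_of_neg h, div_le_div_right_of_neg h, Real.log_le_log_iff hx hy]
    constructor <;> intro <;> linarith
  · rw [Real.sign_of_pos h, div_le_div_iff_of_pos_right h, Real.log_le_log_iff hy hx]
    simp

theorem argmaxOn_nonempty_of_finite [Finite α] [Nonempty α] (f : α → ℝ) :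
    (argmaxOn Set.univ f).Nonempty := by
  obtain ⟨x, hx⟩ := Finite.exists_max f
  exact ⟨x, trivial, fun y _ => hx y⟩

variable {S A : Type*} [Fintype S]

theorem isCompact_l1Ball (Q : S → ℝ) (c : ℝ) : IsCompact (l1Ball Q c) :=
  (isCompact_stdSimplex ℝ S).inter_right
    (isClosed_le (f := fun P : S → ℝ => ∑ s, |P s - Q s|) (by fun_prop) continuous_const)

theorem valueOptimism_nonempty (β : ℝ) {Q : S → ℝ} {c : ℝ} (hQ : Q ∈ stdSimplex ℝ S)
    (hc : 0 ≤ c) (W : S → ℝ) : (valueOptimism β Q c W).Nonempty := by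
  obtain ⟨P, hP, hmax⟩ := (isCompact_l1Ball Q c).exists_isMaxOn ⟨Q, hQ, by simpa using hc⟩
    (f := fun P : S → ℝ => Real.sign β * ∑ s, P s * W s) (by fun_prop)
  exact ⟨P, hP, fun y hy => hmax hy⟩

theorem sum_mul_pos_of_mem_stdSimplex {P W : S → ℝ} (hP : P ∈ stdSimplex ℝ S)
    (hW : ∀ s, 0 < W s) : 0 < ∑ s, P s * W s := by
  have h0 : ∀ s ∈ Finset.univ, 0 ≤ P s * W s := fun s _ => mul_nonneg (hP.1 s) (hW s).le
  refine (Finset.sum_nonneg h0).lt_of_ne fun h => ?_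
  have h1 := (Finset.sum_eq_zero_iff_of_nonneg h0).1 h.symm
  have h2 : ∑ s, P s = 0 := Finset.sum_eq_zero fun s hs => by
    simpa [(hW s).ne'] using h1 s hs
  linarith [hP.2]

/-- `W` gives the exponential moments at `β` of the laws `ν`. -/
def HasExpMoment (β : ℝ) (ν : MeasureTheory.Measure ℝ) (w : ℝ) : Prop :=
  0 < w ∧ ∫⁻ x, ENNReal.ofReal (Real.exp (β * x)) ∂ν = ENNReal.ofReal w

theorem HasExpMoment.entRM_eq {β w : ℝ} {ν : MeasureTheory.Measure ℝ}
    (h : HasExpMoment β ν w) : entRM β ν = Real.log w / β :=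
  entRM_eq_of_lintegral h.1.le h.2

theorem HasExpMoment.dirac (β x : ℝ) :
    HasExpMoment β (MeasureTheory.Measure.dirac x) (Real.exp (β * x)) :=
  ⟨Real.exp_pos _, MeasureTheory.lintegral_dirac' _ (by fun_prop)⟩

theorem HasExpMoment.mixture {β : ℝ} {ν : S → MeasureTheory.Measure ℝ} {W P : S → ℝ}
    (h : ∀ s, HasExpMoment β (ν s) (W s)) (hP : P ∈ stdSimplex ℝ S) :
    HasExpMoment β (mixture P ν) (∑ s, P s * W s) := by
  refine ⟨sum_mul_pos_of_mem_stdSimplex hP fun s => (h s).1, ?_⟩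
  rw [RiskRL.mixture, MeasureTheory.lintegral_finsetSum_measure,
    ENNReal.ofReal_sum_of_nonneg fun s _ => mul_nonneg (hP.1 s) (h s).1.le]
  refine Finset.sum_congr rfl fun s _ => ?_
  rw [MeasureTheory.lintegral_smul_measure, (h s).2, ENNReal.ofReal_mul (hP.1 s), smul_eq_mul]

theorem HasExpMoment.map_add {β w : ℝ} {ν : MeasureTheory.Measure ℝ}
    (h : HasExpMoment β ν w) (r : ℝ) :
    HasExpMoment β (ν.map fun x => x + r) (Real.exp (β * r) * w) := by
  refine ⟨mul_pos (Real.exp_pos _) h.1, ?_⟩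
  rw [MeasureTheory.lintegral_map (by fun_prop) (by fun_prop)]
  simp only [mul_add, Real.exp_add, ENNReal.ofReal_mul (Real.exp_pos _).le]
  rw [MeasureTheory.lintegral_mul_const _ (by fun_prop), h.2, mul_comm]

/-- The two objectives order the ball in the same way, and an argmax depends only on the order.
Equality as sets is what makes a common rule pick the same model. -/
theorem distOptimism_eq {β : ℝ} (hβ : β ≠ 0) (Q : S → ℝ) (c : ℝ)
    {ν : S → MeasureTheory.Measure ℝ} {W : S → ℝ} (h : ∀ s, HasExpMoment β (ν s) (W s)) :
    distOptimism β Q c ν = valueOptimism β Q c W := by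
  refine argmaxOn_congr fun P hP P' hP' => ?_
  rw [(HasExpMoment.mixture h hP.1).entRM_eq, (HasExpMoment.mixture h hP'.1).entRM_eq]
  exact log_div_le_log_div_iff hβ (HasExpMoment.mixture h hP.1).1 (HasExpMoment.mixture h hP'.1).1

variable [DecidableEq S] [DecidableEq A]

theorem empModel_mem_stdSimplex [Nonempty S] (F : History S A) (h : ℕ) (s : S) (a : A) :
    empModel F h s a ∈ stdSimplex ℝ S := by
  constructor
  · intro s'
    simp only [empModel]
    split_ifs <;> positivity
  · simp only [empModel]
    split_ifs with hN
    · rw [← Finset.sum_div, ← Nat.cast_sum]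
      exact div_self (by exact_mod_cast hN.ne')
    · simp

variable [Nonempty S] (H : ℕ) (r : ℕ → S → A → ℝ) {β : ℝ} (ι : ℝ) (tb : TieBreak S A)
  (F : History S A)

theorem model_mem (β : ℝ) (W : S → ℝ) (h : ℕ) (s : S) (a : A) :
    tb.model h s a (valueOptimism β (empModel F h s a) (optRadius ι F h s a) W) ∈
      valueOptimism β (empModel F h s a) (optRadius ι F h s a) W :=
  tb.model_mem h s a _
    (valueOptimism_nonempty β (empModel_mem_stdSimplex F h s a) (Real.sqrt_nonneg _) W)

theorem HasExpMoment.rodiEta (hβ : β ≠ 0) {ν : S → MeasureTheory.Measure ℝ} {W : S → ℝ}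
    (hν : ∀ s, HasExpMoment β (ν s) (W s)) (h : ℕ) (s : S) (a : A) :
    HasExpMoment β (rodiEta H r β ι tb F ν h s a) (roviJ H r β ι tb F W h s a) := by
  simp only [RiskRL.rodiEta, roviJ, distOptimism_eq hβ _ _ hν]
  split_ifs
  · exact (HasExpMoment.mixture hν (model_mem ι tb F β W h s a).1.1).map_add _
  · exact HasExpMoment.dirac _ _

theorem rodiAct_eq_roviAct (hβ : β ≠ 0) {ν : S → MeasureTheory.Measure ℝ} {W : S → ℝ}
    (hν : ∀ s, HasExpMoment β (ν s) (W s)) (h : ℕ) (s : S) :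
    rodiAct H r β ι tb F ν h s = roviAct H r β ι tb F W h s := by
  simp only [rodiAct, roviAct]
  congr 1
  refine argmaxOn_congr fun a _ a' _ => ?_
  have h1 := HasExpMoment.rodiEta H r ι tb F hβ hν h s a
  have h2 := HasExpMoment.rodiEta H r ι tb F hβ hν h s a'
  rw [h1.entRM_eq, h2.entRM_eq]
  exact log_div_le_log_div_iff hβ h1.1 h2.1

theorem hasExpMoment_rodiNu (hβ : β ≠ 0) (n : ℕ) (s : S) :
    HasExpMoment β (rodiNu H r β ι tb F n s) (roviW H r β ι tb F n s) := by
  induction n generalizing s with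
  | zero => simpa [rodiNu, roviW] using HasExpMoment.dirac β 0
  | succ n ih =>
    simp only [rodiNu, roviW, rodiAct_eq_roviAct H r ι tb F hβ ih]
    exact HasExpMoment.rodiEta H r ι tb F hβ ih _ _ _

/-- RODI-MB and ROVI compute the same policies. -/
theorem rodiMB_eq_rovi (hβ : β ≠ 0) (tie : History S A → TieBreak S A) :
    rodiMB H r β ι tie = rovi H r β ι tie := by
  funext F h s
  exact rodiAct_eq_roviAct H r ι (tie F) F hβ (hasExpMoment_rodiNu H r ι (tie F) F hβ _) h s

end Equivalence

/-! ## Visit counts -/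

section Counts

variable {S A : Type*} [DecidableEq S] [DecidableEq A]

/-- The number (`0` or `1`) of transitions `(s, a, s')` recorded in `o`. -/
def hit (o : Option (S × A × S)) (s : S) (a : A) (s' : S) : ℕ :=
  if o = some (s, a, s') then 1 else 0

theorem transCount_cons (e : Episode S A) (F : History S A) (h : ℕ) (s : S) (a : A) (s' : S) :
    transCount (e :: F) h s a s' = transCount F h s a s' + hit e.2[h]? s a s' := by
  simp [transCount, hit, List.countP_cons]

variable [Fintype S]

theorem visitCount_cons (e : Episode S A) (F : History S A) (h : ℕ) (s : S) (a : A) :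
    visitCount (e :: F) h s a = visitCount F h s a + ∑ s', hit e.2[h]? s a s' := by
  simp [visitCount, transCount_cons, Finset.sum_add_distrib]

theorem sum_hit_some (s₁ : S) (a₁ : A) (s₂ : S) (s : S) (a : A) :
    ∑ s', hit (some (s₁, a₁, s₂)) s a s' = if s₁ = s ∧ a₁ = a then 1 else 0 := by
  by_cases h : s₁ = s ∧ a₁ = a
  · simp [hit, h]
  · rw [if_neg h]
    refine Finset.sum_eq_zero fun s' _ => ?_
    simp only [hit, Option.some.injEq, Prod.mk.injEq, ite_eq_right_iff, one_ne_zero, imp_false]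
    tauto

theorem sum_visitCount_le_length [Fintype A] (F : History S A) (h : ℕ) :
    ∑ x : S × A, visitCount F h x.1 x.2 ≤ F.length := by
  induction F with
  | nil => simp [visitCount, transCount]
  | cons e F ih =>
    simp only [visitCount_cons, Finset.sum_add_distrib, List.length_cons]
    refine add_le_add ih ?_
    rcases e.2[h]? with _ | ⟨s₁, a₁, s₂⟩
    · simp [hit]
    · simp only [sum_hit_some]
      rw [← Finset.sum_filter, Finset.sum_const, smul_eq_mul, mul_one]
      refine Finset.card_le_one.2 ?_
      simp only [Finset.mem_filter, Finset.mem_univ, true_and, Prod.forall, Prod.mk.injEq]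
      rintro a b ⟨rfl, rfl⟩ c d ⟨rfl, rfl⟩
      exact ⟨rfl, rfl⟩

theorem visitCount_le_length [Fintype A] (F : History S A) (h : ℕ) (s : S) (a : A) :
    visitCount F h s a ≤ F.length :=
  (Finset.single_le_sum (f := fun x : S × A => visitCount F h x.1 x.2)
    (fun _ _ => Nat.zero_le _) (Finset.mem_univ (s, a))).trans (sum_visitCount_le_length F h)

end Counts

/-! ## Concentration of the empirical models -/

section Concentration

variable {S A : Type*} [Fintype S]

/-- Both have mass one, so excess and deficit balance. An `ℓ¹` deviation is thereby a one-sided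
deviation of the mass of one subset, at the price of a union bound over `2 ^ S` subsets. -/
theorem sum_abs_sub_eq {P Q : S → ℝ} (hP : P ∈ stdSimplex ℝ S) (hQ : Q ∈ stdSimplex ℝ S) :
    ∑ s, |P s - Q s| = 2 * ∑ s with P s < Q s, (Q s - P s) := by
  have h0 : ∑ s, (Q s - P s) = 0 := by rw [Finset.sum_sub_distrib, hP.2, hQ.2, sub_self]
  suffices h : ∑ s, (|P s - Q s| + (Q s - P s)) = 2 * ∑ s with P s < Q s, (Q s - P s) by
    rwa [Finset.sum_add_distrib, h0, add_zero] at h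
  rw [Finset.sum_filter, Finset.mul_sum]
  refine Finset.sum_congr rfl fun s _ => ?_
  split_ifs with h
  · rw [abs_of_neg (by linarith)]; ring
  · rw [abs_of_nonneg (by linarith)]; ring

variable [DecidableEq S]

/-- **Hoeffding's lemma** for the indicator of a set under a probability mass function. -/
theorem sum_toReal_mul_exp_indicator_le (p : PMF S) (B : Finset S) (l : ℝ) :
    ∑ s, (p s).toReal *
      Real.exp (l * ((if s ∈ B then 1 else 0) - ∑ s' ∈ B, (p s').toReal)) ≤
      Real.exp (l ^ 2 / 8) := by
  let _ : MeasurableSpace S := ⊤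
  have : MeasurableSingletonClass S := ⟨fun _ => trivial⟩
  have hb : ∀ᵐ s ∂p.toMeasure, (fun s => if s ∈ B then (1 : ℝ) else 0) s ∈ Set.Icc (0 : ℝ) 1 :=
    Filter.Eventually.of_forall fun s => by by_cases h : s ∈ B <;> simp [h]
  have h := (ProbabilityTheory.hasSubgaussianMGF_of_mem_Icc
    (Measurable.of_discrete).aemeasurable hb).mgf_le l
  simp only [ProbabilityTheory.mgf, PMF.integral_eq_sum, smul_eq_mul, mul_ite, mul_one,
    mul_zero, Finset.sum_ite_mem, Finset.univ_inter] at h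
  refine h.trans_eq ?_
  congr 1
  norm_num
  ring

variable [DecidableEq A] {H : ℕ} (M : EpisodicMDP S A H)

/-- The exponential moment of the deviation of the visits of the set `B` from its expectation. -/
noncomputable def devMoment (h : ℕ) (s : S) (a : A) (B : Finset S) (l : ℝ) (F : History S A) :
    ℝ≥0∞ :=
  ENNReal.ofReal (Real.exp (l * ((∑ s' ∈ B, transCount F h s a s' : ℕ) -
    (visitCount F h s a : ℝ) * ∑ s' ∈ B, (M.P h s a s').toReal) -
      (visitCount F h s a : ℝ) * (l ^ 2 / 8)))

/-- A new episode multiplies the moment by a factor that is 1 unless `(s, a)` is visited at step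
`h`; if it is visited, the factor has mean at most 1 by Hoeffding's lemma. -/
theorem expect_devMoment_le (π : Policy S A) (F : History S A) (h : ℕ) (s : S) (a : A)
    (B : Finset S) (l : ℝ) (s₀ : S) :
    expect (rollout M π H 0 s₀) (fun e => devMoment M h s a B l ((s₀, e) :: F)) ≤
      devMoment M h s a B l F := by
  set p : ℝ := ∑ s' ∈ B, (M.P h s a s').toReal with hp
  let g : Option (S × A × S) → ℝ≥0∞ := fun o =>
    ENNReal.ofReal (Real.exp (l * ((∑ s' ∈ B, hit o s a s' : ℕ) -
      (∑ s', hit o s a s' : ℕ) * p) - (∑ s', hit o s a s' : ℕ) * (l ^ 2 / 8)))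
  have hg : ∀ e : List (S × A × S),
      devMoment M h s a B l ((s₀, e) :: F) = devMoment M h s a B l F * g e[h]? := by
    intro e
    simp only [devMoment, g]
    rw [← ENNReal.ofReal_mul (Real.exp_pos _).le, ← Real.exp_add, visitCount_cons, ← hp]
    simp only [transCount_cons, Finset.sum_add_distrib]
    push_cast
    congr 2
    ring
  simp only [hg, expect_const_mul]
  refine mul_le_of_le_one_right' (expect_rollout_getElem_le_one M π (by simp [g, hit]) _ _ _ ?_)
  intro s₁ a₁
  rw [zero_add]
  by_cases hs : s₁ = s ∧ a₁ = a
  · obtain ⟨rfl, rfl⟩ := hs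
    simp only [g, sum_hit_some, and_self, if_true]
    rw [expect_ofReal _ fun _ => (Real.exp_pos _).le, ← ENNReal.ofReal_one]
    refine ENNReal.ofReal_le_ofReal ?_
    have h1 := sum_toReal_mul_exp_indicator_le (M.P h s₁ a₁) B l
    have h2 : ∀ s', Real.exp (l * ((∑ x ∈ B, hit (some (s₁, a₁, s')) s₁ a₁ x : ℕ) -
        ((1 : ℕ) : ℝ) * p) - ((1 : ℕ) : ℝ) * (l ^ 2 / 8)) =
        Real.exp (l * ((if s' ∈ B then 1 else 0) - p)) * Real.exp (-(l ^ 2 / 8)) := by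
      intro s'
      rw [← Real.exp_add]
      simp [hit, sub_eq_add_neg]
    simp only [h2, ← mul_assoc, ← Finset.sum_mul]
    rw [Real.exp_neg]
    exact (mul_le_mul_of_nonneg_right h1 (by positivity)).trans_eq
      (mul_inv_cancel₀ (Real.exp_pos _).ne')
  · have h3 : ∀ s' x, hit (some (s₁, a₁, s')) s a x = 0 := fun s' x => by
      simp only [hit, Option.some.injEq, Prod.mk.injEq, ite_eq_right_iff, one_ne_zero, imp_false]
      tauto
    simp [g, h3, expect_const]

/-- The true transition probabilities of all visited pairs lie in the confidence balls. -/
def Concentrated (ι : ℝ) (F : History S A) : Prop :=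
  ∀ h < H, ∀ s a, 0 < visitCount F h s a →
    (fun s' => (M.P h s a s').toReal) ∈ l1Ball (empModel F h s a) (optRadius ι F h s a)

variable [Nonempty S] {M}

/-- Treated apart because the union bound below extracts two factors `2 exp (-ι)`, which requires at
least two states. -/
theorem concentrated_of_subsingleton [Subsingleton S] (ι : ℝ) (F : History S A) :
    Concentrated M ι F := by
  intro h _ s a _
  refine ⟨toReal_mem_stdSimplex _, ?_⟩
  have h1 : ∀ P ∈ stdSimplex ℝ S, ∀ x, P x = 1 := fun P hP x => by
    rw [← hP.2, Fintype.sum_subsingleton _ x]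
  have h2 : ∀ x, (M.P h s a x).toReal = 1 := h1 _ (toReal_mem_stdSimplex _)
  simp only [h2, h1 _ (empModel_mem_stdSimplex F h s a), sub_self, abs_zero,
    Finset.sum_const_zero]
  exact Real.sqrt_nonneg _

/-- With `ε` the radius and `N` the count, the set `B` where the empirical model exceeds the kernel
has excess above `ε / 2`. At the parameter `2 ε` the exponent is then at least `N ε ^ 2 - N ε ^ 2 /
2 = S ι`. -/
theorem exists_devMoment_ge_of_not_concentrated {ι : ℝ} (hι : 0 ≤ ι) {F : History S A}
    (hF : ¬ Concentrated M ι F) :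
    ∃ h < H, ∃ s a, 0 < visitCount F h s a ∧ ∃ B,
      ENNReal.ofReal (Real.exp (Fintype.card S * ι)) ≤ devMoment M h s a B
        (2 * Real.sqrt (2 * Fintype.card S * ι / visitCount F h s a)) F := by
  simp only [Concentrated, not_forall] at hF
  obtain ⟨h, hh, s, a, hN, hnot⟩ := hF
  refine ⟨h, hh, s, a, hN, Finset.univ.filter
    (fun s' => (M.P h s a s').toReal < empModel F h s a s'), ENNReal.ofReal_le_ofReal
    (Real.exp_le_exp.2 ?_)⟩
  have h1 : optRadius ι F h s a < ∑ s', |(M.P h s a s').toReal - empModel F h s a s'| := by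
    by_contra! h1
    exact hnot ⟨toReal_mem_stdSimplex _, h1⟩
  rw [sum_abs_sub_eq (toReal_mem_stdSimplex _) (empModel_mem_stdSimplex F h s a)] at h1
  have hN1 : (1 : ℝ) ≤ visitCount F h s a := by exact_mod_cast hN
  rw [optRadius, max_eq_left hN1] at h1
  set N : ℝ := (visitCount F h s a : ℝ)
  set B := Finset.univ.filter (fun s' => (M.P h s a s').toReal < empModel F h s a s')
  set ε := Real.sqrt (2 * Fintype.card S * ι / N) with hε
  have hε2 : ε ^ 2 * N = 2 * Fintype.card S * ι := by
    rw [hε, Real.sq_sqrt (by positivity), div_mul_cancel₀ _ (by positivity)]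
  have h2 : N * ∑ s' ∈ B, (empModel F h s a s' - (M.P h s a s').toReal) =
      (∑ s' ∈ B, transCount F h s a s' : ℕ) - N * ∑ s' ∈ B, (M.P h s a s').toReal := by
    rw [Finset.sum_sub_distrib, mul_sub, Finset.mul_sum]
    push_cast
    congr 1
    refine Finset.sum_congr rfl fun s' _ => ?_
    rw [empModel, if_pos hN, mul_div_cancel₀ _ (by positivity)]
  rw [← h2]
  have hε0 : 0 ≤ ε := Real.sqrt_nonneg _
  have h3 : ε * N * ε ≤
      ε * N * (2 * ∑ s' ∈ B, (empModel F h s a s' - (M.P h s a s').toReal)) :=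
    mul_le_mul_of_nonneg_left h1.le (by positivity)
  nlinarith

theorem toOuterMeasure_not_concentrated_le [Fintype A] {ι : ℝ} (hι : 0 ≤ ι)
    (init : History S A → PMF S) (alg : Algorithm S A) (K : ℕ) :
    (historyLaw M init alg K).toOuterMeasure {F | ¬ ∀ F', F' <:+ F → Concentrated M ι F'} ≤
      ENNReal.ofReal (H * Fintype.card S * Fintype.card A * 2 ^ Fintype.card S * K *
        Real.exp (-(Fintype.card S * ι))) := by
  let c := ENNReal.ofReal (Real.exp (Fintype.card S * ι))
  -- The parameter tuned to a visit count must be fixed in advance for Ville's inequality, so the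
  -- union also runs over the counts; the element `i` of `Fin K` stands for the count `i + 1`.
  let I := Fin H × S × A × Finset S × Fin K
  let X : I → Set (History S A) := fun i => {F | ∃ F', F' <:+ F ∧ c ≤
    devMoment M i.1 i.2.1 i.2.2.1 i.2.2.2.1
      (2 * Real.sqrt (2 * Fintype.card S * ι / ((i.2.2.2.2 + 1 : ℕ) : ℝ))) F'}
  have hX : ∀ i, (historyLaw M init alg K).toOuterMeasure (X i) ≤
      ENNReal.ofReal (Real.exp (-(Fintype.card S * ι))) := by
    intro i
    have h := ville_inequality (M := M) (init := init) (alg := alg)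
      (fun F s => expect_devMoment_le M (alg F) F i.1 i.2.1 i.2.2.1 i.2.2.2.1
        (2 * Real.sqrt (2 * Fintype.card S * ι / ((i.2.2.2.2 + 1 : ℕ) : ℝ))) s) c K
    have h1 : devMoment M i.1 i.2.1 i.2.2.1 i.2.2.2.1
        (2 * Real.sqrt (2 * Fintype.card S * ι / ((i.2.2.2.2 + 1 : ℕ) : ℝ))) [] = 1 := by
      simp [devMoment, visitCount, transCount]
    rw [h1] at h
    rw [Real.exp_neg, ENNReal.ofReal_inv_of_pos (Real.exp_pos _)]
    rw [mul_comm] at h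
    exact ENNReal.le_inv_iff_mul_le.2 h
  refine (toOuterMeasure_historyLaw_mono (Y := ⋃ i, X i) ?_).trans
    ((MeasureTheory.measure_iUnion_fintype_le _ _).trans
      ((Finset.sum_le_sum fun i _ => hX i).trans_eq ?_))
  · intro F hF hlen
    simp only [Set.mem_ofPred_eq, not_forall] at hF
    obtain ⟨F', hsuf, hnc⟩ := hF
    obtain ⟨h, hh, s, a, hN, B, hB⟩ := exists_devMoment_ge_of_not_concentrated hι hnc
    have hle : visitCount F' h s a ≤ K :=
      (visitCount_le_length F' h s a).trans (hlen ▸ hsuf.length_le)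
    refine Set.mem_iUnion.2 ⟨(⟨h, hh⟩, s, a, B, ⟨visitCount F' h s a - 1, by omega⟩),
      F', hsuf, ?_⟩
    simpa [Nat.sub_add_cancel (show 1 ≤ visitCount F' h s a from hN)] using hB
  · simp only [I, Finset.sum_const, Finset.card_univ, Fintype.card_prod, Fintype.card_fin,
      Fintype.card_finset, nsmul_eq_mul]
    rw [← ENNReal.ofReal_natCast, ← ENNReal.ofReal_mul (Nat.cast_nonneg _)]
    congr 1
    push_cast
    ring

/-- With probability at least `1 - δ / 2`, all empirical models concentrate. -/
theorem toOuterMeasure_not_concentrated_le_half [Fintype A] [Nonempty A] {ι δ : ℝ} (hH : 1 ≤ H)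
    {K : ℕ} (hK : 4 ≤ K) (hδ0 : 0 < δ) (hδ1 : δ < 1)
    (hι : Real.log ((Fintype.card S : ℝ) * Fintype.card A * (K * H) / δ) ≤ ι)
    (init : History S A → PMF S) (alg : Algorithm S A) :
    (historyLaw M init alg K).toOuterMeasure {F | ¬ ∀ F', F' <:+ F → Concentrated M ι F'} ≤
      ENNReal.ofReal (δ / 2) := by
  rcases subsingleton_or_nontrivial S with hS | hS
  · have h : {F : History S A | ¬ ∀ F', F' <:+ F → Concentrated M ι F'} = ∅ := by
      ext F
      simpa using fun F' _ => concentrated_of_subsingleton ι F'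
    rw [h]
    simp
  have hS2 : 2 ≤ Fintype.card S := Fintype.one_lt_card
  have hA1 : 1 ≤ Fintype.card A := Fintype.card_pos
  have hS' : (2 : ℝ) ≤ Fintype.card S := by exact_mod_cast hS2
  have hA' : (1 : ℝ) ≤ Fintype.card A := by exact_mod_cast hA1
  have hH' : (1 : ℝ) ≤ H := by exact_mod_cast hH
  have hK' : (4 : ℝ) ≤ K := by exact_mod_cast hK
  have hT : (8 : ℝ) ≤ Fintype.card S * Fintype.card A * (K * H) := by
    calc (8 : ℝ) = 2 * 1 * (4 * 1) := by norm_num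
      _ ≤ _ := by gcongr
  set T : ℝ := Fintype.card S * Fintype.card A * (K * H) with hTdef
  have hTδ : 8 ≤ T / δ := by
    rw [le_div_iff₀ hδ0]
    nlinarith
  have hι0 : 0 ≤ ι := (Real.log_nonneg (by linarith)).trans hι
  refine (toOuterMeasure_not_concentrated_le hι0 init alg K).trans (ENNReal.ofReal_le_ofReal ?_)
  set x : ℝ := Real.exp (-ι) with hx
  have hx0 : 0 < x := Real.exp_pos _
  have hxT : x * T ≤ δ := by
    have h1 : x ≤ (T / δ)⁻¹ := by
      rw [hx, Real.exp_neg]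
      exact inv_anti₀ (by linarith) ((Real.log_le_iff_le_exp (by linarith)).1 hι)
    rw [inv_div, le_div_iff₀ (by linarith)] at h1
    exact h1
  -- Of the factors `(2 x) ^ S`, one cancels `T` and yields `2 δ`, a second contributes the `1 / 4`
  -- that brings this down to `δ / 2`, and the others are at most 1.
  have hx8 : 2 * x ≤ 1 / 4 := by nlinarith
  obtain ⟨m, hm⟩ : ∃ m, Fintype.card S = m + 2 := ⟨Fintype.card S - 2, by omega⟩
  have hexp : Real.exp (-(Fintype.card S * ι)) = x ^ Fintype.card S := by
    rw [hx, ← Real.exp_nat_mul]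
    congr 1
    ring
  have hpow : (2 * x) ^ m ≤ 1 := pow_le_one₀ (by positivity) (by linarith)
  calc (H : ℝ) * Fintype.card S * Fintype.card A * 2 ^ Fintype.card S * K *
        Real.exp (-(Fintype.card S * ι)) = T * (2 * x) ^ (m + 2) := by
        rw [hexp, hTdef, mul_pow, ← hm]; ring
    _ = (x * T) * 2 * (2 * x) * (2 * x) ^ m := by ring
    _ ≤ δ * 2 * (1 / 4) * 1 := by gcongr
    _ = δ / 2 := by ring

end Concentration

/-! ## Ranges of exponential values -/

section Range

/-- `w` lies between `1` and `exp (β n)`. -/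
def InRange (β n w : ℝ) : Prop :=
  Real.sign β ≤ Real.sign β * w ∧ Real.sign β * w ≤ Real.sign β * Real.exp (β * n)

variable {β n w : ℝ}

theorem inRange_of_neg (h : β < 0) : InRange β n w ↔ w ≤ 1 ∧ Real.exp (β * n) ≤ w := by
  rw [InRange, Real.sign_of_neg h]
  constructor <;> rintro ⟨h1, h2⟩ <;> constructor <;> linarith

theorem inRange_of_pos (h : 0 < β) : InRange β n w ↔ 1 ≤ w ∧ w ≤ Real.exp (β * n) := by
  rw [InRange, Real.sign_of_pos h]
  simp

theorem InRange.pos (hβ : β ≠ 0) (h : InRange β n w) : 0 < w := by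
  rcases hβ.lt_or_gt with hb | hb
  · exact (Real.exp_pos _).trans_le ((inRange_of_neg hb).1 h).2
  · exact one_pos.trans_le ((inRange_of_pos hb).1 h).1

theorem inRange_exp (hβ : β ≠ 0) (hn : 0 ≤ n) : InRange β n (Real.exp (β * n)) := by
  rcases hβ.lt_or_gt with hb | hb
  · rw [inRange_of_neg hb, Real.exp_le_one_iff]
    exact ⟨mul_nonpos_of_nonpos_of_nonneg hb.le hn, le_rfl⟩
  · rw [inRange_of_pos hb, Real.one_le_exp_iff]
    exact ⟨by positivity, le_rfl⟩

theorem InRange.sum {S : Type*} [Fintype S] {P W : S → ℝ} (hP : P ∈ stdSimplex ℝ S)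
    (hW : ∀ s, InRange β n (W s)) : InRange β n (∑ s, P s * W s) := by
  have h1 : ∀ c : ℝ, c = ∑ s, P s * c := fun c => by rw [← Finset.sum_mul, hP.2, one_mul]
  have h2 : Real.sign β * ∑ s, P s * W s = ∑ s, P s * (Real.sign β * W s) := by
    rw [Finset.mul_sum]
    exact Finset.sum_congr rfl fun s _ => by ring
  rw [InRange, h2]
  constructor
  · exact (h1 (Real.sign β)).trans_le
      (Finset.sum_le_sum fun s _ => mul_le_mul_of_nonneg_left (hW s).1 (hP.1 s))
  · exact (Finset.sum_le_sum fun s _ =>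
      mul_le_mul_of_nonneg_left (hW s).2 (hP.1 s)).trans_eq (h1 _).symm

theorem InRange.exp_mul (hβ : β ≠ 0) (hw : InRange β n w) {r : ℝ} (hr : r ∈ Set.Icc (0 : ℝ) 1) :
    InRange β (n + 1) (Real.exp (β * r) * w) := by
  have h0 : Real.exp (β * (n + 1)) = Real.exp β * Real.exp (β * n) := by
    rw [← Real.exp_add]; ring_nf
  have hw0 := hw.pos hβ
  rcases hβ.lt_or_gt with hb | hb
  · rw [inRange_of_neg hb] at hw ⊢
    have h1 : Real.exp (β * r) ≤ 1 :=
      Real.exp_le_one_iff.2 (mul_nonpos_of_nonpos_of_nonneg hb.le hr.1)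
    have h2 : Real.exp β ≤ Real.exp (β * r) := Real.exp_le_exp.2 (by nlinarith [hr.2])
    rw [h0]
    exact ⟨mul_le_one₀ h1 hw0.le hw.1, by gcongr; exact hw.2⟩
  · rw [inRange_of_pos hb] at hw ⊢
    have h1 : 1 ≤ Real.exp (β * r) := Real.one_le_exp_iff.2 (mul_nonneg hb.le hr.1)
    have h2 : Real.exp (β * r) ≤ Real.exp β := Real.exp_le_exp.2 (by nlinarith [hr.2])
    rw [h0]
    exact ⟨one_le_mul_of_one_le_of_one_le h1 hw.1, by gcongr; exact hw.2⟩

/-- The width `|exp (β n) - 1|` of the range of the exponential values over `n` steps. -/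
noncomputable def width (β n : ℝ) : ℝ := Real.sign β * (Real.exp (β * n) - 1)

theorem width_nonneg (hβ : β ≠ 0) (hn : 0 ≤ n) : 0 ≤ width β n := by
  have h := (inRange_exp hβ hn).1
  rw [width]
  linarith

/-- For `β > 0` the factor is at most `exp β`, and `exp β * (exp (β n) - 1) ≤ exp (β (n + 1)) - 1`.
For `β < 0` the factor is at most 1 and the width grows with `n`. This keeps errors from compounding
over the steps. -/
theorem exp_mul_width_le (hβ : β ≠ 0) (hn : 0 ≤ n) {r : ℝ} (hr : r ∈ Set.Icc (0 : ℝ) 1) :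
    Real.exp (β * r) * width β n ≤ width β (n + 1) := by
  have h0 : Real.exp (β * (n + 1)) = Real.exp β * Real.exp (β * n) := by
    rw [← Real.exp_add]; ring_nf
  have hw := width_nonneg hβ hn
  rcases hβ.lt_or_gt with hb | hb
  · rw [width, Real.sign_of_neg hb] at hw ⊢
    have h1 : Real.exp (β * r) ≤ 1 :=
      Real.exp_le_one_iff.2 (mul_nonpos_of_nonpos_of_nonneg hb.le hr.1)
    have h2 : Real.exp β ≤ 1 := Real.exp_le_one_iff.2 hb.le
    rw [width, Real.sign_of_neg hb, h0]
    nlinarith [Real.exp_pos (β * n), mul_le_mul_of_nonneg_right h1 hw]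
  · rw [width, Real.sign_of_pos hb] at hw ⊢
    have h2 : Real.exp (β * r) ≤ Real.exp β := Real.exp_le_exp.2 (by nlinarith [hr.2])
    have h3 : 1 ≤ Real.exp β := Real.one_le_exp_iff.2 hb.le
    rw [width, Real.sign_of_pos hb, h0]
    nlinarith [mul_le_mul_of_nonneg_right h2 hw]

/-- For `β > 0` the logarithm has slope at most 1 on `[1, ∞)`. For `β < 0` its slope on `[exp (β n),
1]` is at most `exp (-β n)`, and `exp (-β n) * (1 - exp (β n)) = exp (|β| n) - 1`. Both signs give
the same constant. -/
theorem width_div_le (hβ : β ≠ 0) {a b : ℝ} (ha : InRange β n a) (hb : InRange β n b)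
    {c : ℝ} (hab : Real.sign β * b ≤ Real.sign β * a)
    (h : Real.sign β * (a - b) ≤ width β n * c) :
    Real.log a / β - Real.log b / β ≤ lipConst β n * c := by
  have ha0 := ha.pos hβ
  have hb0 := hb.pos hβ
  rcases hβ.lt_or_gt with hneg | hpos
  · rw [inRange_of_neg hneg] at ha hb
    rw [width, Real.sign_of_neg hneg] at h
    rw [Real.sign_of_neg hneg] at hab
    have h1 : Real.log b - Real.log a ≤ b / a - 1 := by
      rw [← Real.log_div hb0.ne' ha0.ne']
      exact Real.log_le_sub_one_of_pos (by positivity)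
    have h2 : b / a - 1 ≤ (b - a) * Real.exp (-(β * n)) := by
      rw [div_sub_one ha0.ne', Real.exp_neg, ← div_eq_mul_inv]
      exact div_le_div_of_nonneg_left (by linarith) (Real.exp_pos _) ha.2
    have h3 : (b - a) * Real.exp (-(β * n)) ≤
        (1 - Real.exp (β * n)) * c * Real.exp (-(β * n)) := by
      gcongr
      linarith
    have h4 : Real.exp (β * n) * Real.exp (-(β * n)) = 1 := by
      rw [← Real.exp_add]; simp
    have h5 : (1 - Real.exp (β * n)) * c * Real.exp (-(β * n)) =
        (Real.exp (-(β * n)) - 1) * c := by linear_combination (-c) * h4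
    rw [lipConst, abs_of_neg hneg, neg_mul, div_mul_eq_mul_div, ← sub_div, ← neg_div_neg_eq]
    exact div_le_div_of_nonneg_right (by linarith) (by linarith)
  · rw [inRange_of_pos hpos] at ha hb
    rw [width, Real.sign_of_pos hpos] at h
    rw [Real.sign_of_pos hpos] at hab
    have h1 : Real.log a - Real.log b ≤ a / b - 1 := by
      rw [← Real.log_div ha0.ne' hb0.ne']
      exact Real.log_le_sub_one_of_pos (by positivity)
    have h2 : a / b - 1 ≤ a - b := by
      rw [div_sub_one hb0.ne']
      exact div_le_self (by linarith) hb.1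
    rw [lipConst, abs_of_pos hpos, div_mul_eq_mul_div, ← sub_div]
    exact div_le_div_of_nonneg_right (by linarith) hpos.le

theorem InRange.log_div_mem (hβ : β ≠ 0) (h : InRange β n w) :
    Real.log w / β ∈ Set.Icc 0 n := by
  have hw0 := h.pos hβ
  rcases hβ.lt_or_gt with hb | hb
  · rw [inRange_of_neg hb] at h
    refine ⟨div_nonneg_of_nonpos (Real.log_nonpos hw0.le h.1) hb.le, ?_⟩
    rw [div_le_iff_of_neg hb, mul_comm]
    exact (Real.le_log_iff_exp_le hw0).2 h.2
  · rw [inRange_of_pos hb] at h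
    refine ⟨div_nonneg (Real.log_nonneg h.1) hb.le, ?_⟩
    rw [div_le_iff₀ hb, mul_comm]
    exact (Real.log_le_iff_le_exp hw0).2 h.2

theorem le_lipConst (hβ : β ≠ 0) (n : ℝ) : n ≤ lipConst β n := by
  rw [lipConst, le_div_iff₀ (abs_pos.2 hβ), mul_comm]
  linarith [Real.add_one_le_exp (|β| * n)]

end Range

/-! ## Optimism and the regret of one episode -/

section Optimism

variable {S A : Type*} [Fintype S] {H : ℕ} (M : EpisodicMDP S A H) {β : ℝ}

theorem inRange_expValue (hβ : β ≠ 0) (π : Policy S A) (n h : ℕ) (hn : h + n ≤ H) (s : S) :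
    InRange β n (expValue M β π n h s) := by
  induction n generalizing h s with
  | zero => simp [InRange, expValue]
  | succ n ih =>
    push_cast
    exact (InRange.sum (toReal_mem_stdSimplex _) fun s' => ih (h + 1) (by omega) s').exp_mul hβ
      (M.r_mem h (by omega) s _)

theorem value_mem_Icc (hβ : β ≠ 0) (π : Policy S A) (s : S) :
    value M β π s ∈ Set.Icc (0 : ℝ) H := by
  rw [value_eq]
  exact (inRange_expValue M hβ π H 0 (by simp) s).log_div_mem hβ

/-- Since `P - Q` has total mass zero, `W` may be replaced by `W - m`, with values in `[0, R]`. The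
alternative 1 in the minimum permits truncated bonuses. -/
theorem sum_sub_mul_le {P Q W : S → ℝ} (hP : P ∈ stdSimplex ℝ S) (hQ : Q ∈ stdSimplex ℝ S)
    {m R : ℝ} (hR : 0 ≤ R) (h1 : ∀ s, m ≤ W s) (h2 : ∀ s, W s ≤ m + R) :
    ∑ s, P s * W s - ∑ s, Q s * W s ≤ R * min 1 (∑ s, |P s - Q s|) := by
  have h3 : ∑ s, P s * W s - ∑ s, Q s * W s = ∑ s, (P s - Q s) * (W s - m) := by
    simp only [sub_mul, mul_sub, Finset.sum_sub_distrib, ← Finset.sum_mul, hP.2, hQ.2]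
    ring
  rw [h3, mul_min_of_nonneg _ _ hR]
  refine le_min ?_ ?_
  · calc ∑ s, (P s - Q s) * (W s - m) ≤ ∑ s, P s * R := Finset.sum_le_sum fun s _ => by
          nlinarith [h1 s, h2 s, hP.1 s, hQ.1 s, mul_nonneg (hQ.1 s) (sub_nonneg.2 (h1 s)),
            mul_nonneg (hP.1 s) (sub_nonneg.2 (h2 s))]
      _ = R * 1 := by rw [← Finset.sum_mul, hP.2]; ring
  · rw [Finset.mul_sum]
    refine Finset.sum_le_sum fun s _ => ?_
    have h4 := sub_nonneg.2 (h1 s)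
    calc (P s - Q s) * (W s - m) ≤ |P s - Q s| * (W s - m) :=
          mul_le_mul_of_nonneg_right (le_abs_self _) h4
      _ ≤ R * |P s - Q s| := by
          rw [mul_comm]
          exact mul_le_mul_of_nonneg_right (by linarith [h2 s]) (abs_nonneg _)

variable [DecidableEq S] [DecidableEq A]

/-- The (normalized and truncated) exploration bonus of a state-action pair. -/
noncomputable def bonus (H : ℕ) (ι : ℝ) (F : History S A) (h : ℕ) (s : S) (a : A) : ℝ :=
  if h < H then min 1 ((1 + 2 * Real.sqrt (2 * Fintype.card S * ι)) /
    Real.sqrt (max (visitCount F h s a : ℝ) 1)) else 0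

theorem bonus_nonneg (ι : ℝ) (F : History S A) (h : ℕ) (s : S) (a : A) :
    0 ≤ bonus H ι F h s a := by
  rw [bonus]
  split_ifs <;> positivity

theorem bonus_le_one (ι : ℝ) (F : History S A) (h : ℕ) (s : S) (a : A) :
    bonus H ι F h s a ≤ 1 := by
  rw [bonus]
  split_ifs
  · exact min_le_left _ _
  · exact zero_le_one

/-- This is the purpose of the summand 1 in the numerator of `bonus`: truncation is reached at
unvisited pairs however small `ι` is. -/
theorem bonus_of_visitCount_eq_zero (ι : ℝ) {F : History S A} {h : ℕ} (hh : h < H) {s : S} {a : A}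
    (hN : visitCount F h s a = 0) : bonus H ι F h s a = 1 := by
  rw [bonus, if_pos hh, hN]
  refine min_eq_left ?_
  simp only [Nat.cast_zero, zero_le_one, sup_of_le_right, Real.sqrt_one, div_one]
  linarith [Real.sqrt_nonneg (2 * Fintype.card S * ι)]

theorem min_one_two_mul_optRadius_le_bonus (ι : ℝ) (F : History S A) {h : ℕ} (hh : h < H)
    (s : S) (a : A) : min 1 (2 * optRadius ι F h s a) ≤ bonus H ι F h s a := by
  rw [bonus, if_pos hh, optRadius, Real.sqrt_div' _ (by positivity), ← mul_div_assoc]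
  gcongr
  linarith

variable {M} {ι : ℝ} {F : History S A} (tb : TieBreak S A)

theorem sign_mul_roviJ_le [Finite A] [Nonempty A] (W : S → ℝ) (h : ℕ) (s : S) (a : A) :
    Real.sign β * roviJ H M.r β ι tb F W h s a ≤
      Real.sign β * roviJ H M.r β ι tb F W h s (roviAct H M.r β ι tb F W h s) :=
  (tb.act_mem h s _ (argmaxOn_nonempty_of_finite
    fun a => Real.sign β * roviJ H M.r β ι tb F W h s a)).2 a trivial

variable [Nonempty S]

theorem inRange_roviJ (hβ : β ≠ 0) {n h : ℕ} (hn : h + (n + 1) = H) {W : S → ℝ}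
    (hW : ∀ s, InRange β n (W s)) (s : S) (a : A) :
    InRange β (n + 1 : ℕ) (roviJ H M.r β ι tb F W h s a) := by
  rw [roviJ]
  split_ifs
  · push_cast
    exact (InRange.sum (model_mem ι tb F β W h s a).1.1 hW).exp_mul hβ (M.r_mem h (by omega) s a)
  · have h1 : (H : ℝ) - h = (n + 1 : ℕ) := by rw [← hn]; push_cast; ring
    rw [h1]
    exact inRange_exp hβ (Nat.cast_nonneg _)

theorem inRange_roviW (hβ : β ≠ 0) {n : ℕ} (hn : n ≤ H) (s : S) :
    InRange β n (roviW H M.r β ι tb F n s) := by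
  induction n generalizing s with
  | zero => simp [InRange, roviW]
  | succ n ih => exact inRange_roviJ tb hβ (by omega) (fun s => ih (by omega) s) _ _

/-- The exponential values of ROVI are optimistic. -/
theorem sign_mul_expValue_le_roviW [Finite A] [Nonempty A] (hβ : β ≠ 0)
    (hF : Concentrated M ι F) (π : Policy S A) {n h : ℕ} (hn : h + n = H) (s : S) :
    Real.sign β * expValue M β π n h s ≤ Real.sign β * roviW H M.r β ι tb F n s := by
  induction n generalizing h s with
  | zero => simp [expValue, roviW]
  | succ n ih =>
    have hh : H - (n + 1) = h := by omega
    refine le_trans ?_ (sign_mul_roviJ_le (M := M) tb (roviW H M.r β ι tb F n) (H - (n + 1)) s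
      (π h s))
    rw [hh, roviJ]
    split_ifs with hN
    · have h1 := (model_mem ι tb F β (roviW H M.r β ι tb F n) h s (π h s)).2 _
        (hF h (by omega) s (π h s) hN)
      have h2 : Real.sign β * ∑ s', (M.P h s (π h s) s').toReal * expValue M β π n (h + 1) s' ≤
          Real.sign β * ∑ s', (M.P h s (π h s) s').toReal * roviW H M.r β ι tb F n s' := by
        rw [Finset.mul_sum, Finset.mul_sum]
        refine Finset.sum_le_sum fun s' _ => ?_
        rw [mul_left_comm, mul_left_comm (Real.sign β)]
        exact mul_le_mul_of_nonneg_left (ih (by omega) s') ENNReal.toReal_nonneg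
      rw [expValue, mul_left_comm, mul_left_comm (Real.sign β)]
      exact mul_le_mul_of_nonneg_left (h2.trans h1) (Real.exp_pos _).le
    -- At an unvisited pair the value is the optimistic endpoint of the range, so no concentration
    -- is needed.
    · have h1 : (H : ℝ) - h = (n + 1 : ℕ) := by rw [← hn]; push_cast; ring
      rw [h1]
      exact (inRange_expValue M hβ π (n + 1) h hn.le s).2

/-- The excess of the optimistic exponential values over those of the policy of ROVI. -/
theorem sign_mul_roviW_sub_le (hβ : β ≠ 0) (hF : Concentrated M ι F)
    (tie : History S A → TieBreak S A) {n h : ℕ} (hn : h + n = H) (s : S) :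
    Real.sign β * (roviW H M.r β ι (tie F) F n s -
        expValue M β (rovi H M.r β ι tie F) n h s) ≤
      width β n * sumValue M (bonus H ι F) (rovi H M.r β ι tie F) n h s := by
  induction n generalizing h s with
  | zero => simp [expValue, roviW, sumValue]
  | succ n ih =>
    have hh : H - (n + 1) = h := by omega
    have hh' : H - (h + 1) = n := by omega
    set π := rovi H M.r β ι tie F with hπ
    set W := roviW H M.r β ι (tie F) F n with hW
    have hact : roviAct H M.r β ι (tie F) F W h s = π h s := by
      rw [hπ, rovi, hh']
    have hWr : ∀ s, InRange β n (W s) := inRange_roviW (tie F) hβ (by omega)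
    have hw := width_nonneg hβ (Nat.cast_nonneg n)
    have hw' := width_nonneg hβ (Nat.cast_nonneg (n + 1))
    have hr := M.r_mem h (by omega) s (π h s)
    rw [roviW, hh, ← hW]
    beta_reduce
    rw [hact, roviJ]
    have hB : 0 ≤ ∑ s', (M.P h s (π h s) s').toReal *
        sumValue M (bonus H ι F) π n (h + 1) s' :=
      Finset.sum_nonneg fun s' _ =>
        mul_nonneg ENNReal.toReal_nonneg (sumValue_nonneg M π (bonus_nonneg ι F) _ _ _)
    split_ifs with hN
    · set P := (tie F).model h s (π h s) (valueOptimism β (empModel F h s (π h s))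
        (optRadius ι F h s (π h s)) W) with hP
      have hPm : P ∈ valueOptimism β (empModel F h s (π h s)) (optRadius ι F h s (π h s)) W :=
        model_mem ι (tie F) F β W h s (π h s)
      have hQm := hF h (by omega) s (π h s) hN
      -- The selected model and the true kernel both lie in the ball around the empirical model, so
      -- they are at most two radii apart.
      have h1 : ∑ s', P s' * (Real.sign β * W s') -
          ∑ s', (M.P h s (π h s) s').toReal * (Real.sign β * W s') ≤
          width β n * bonus H ι F h s (π h s) := by
        refine (sum_sub_mul_le hPm.1.1 (toReal_mem_stdSimplex _) hw (fun s' => (hWr s').1)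
          fun s' => (hWr s').2.trans_eq (by rw [width]; ring)).trans ?_
        refine mul_le_mul_of_nonneg_left (le_trans (min_le_min_left _ ?_)
          (min_one_two_mul_optRadius_le_bonus ι F (by omega) s (π h s))) hw
        calc ∑ s', |P s' - (M.P h s (π h s) s').toReal| ≤
              ∑ s', (|P s' - empModel F h s (π h s) s'| +
                |(M.P h s (π h s) s').toReal - empModel F h s (π h s) s'|) :=
              Finset.sum_le_sum fun s' _ => by
                rw [abs_sub_comm (M.P h s (π h s) s').toReal]
                exact abs_sub_le _ _ _
          _ ≤ 2 * optRadius ι F h s (π h s) := by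
              rw [Finset.sum_add_distrib, two_mul]
              exact add_le_add hPm.1.2 hQm.2
      have h2 : ∑ s', (M.P h s (π h s) s').toReal *
          (Real.sign β * (W s' - expValue M β π n (h + 1) s')) ≤
          width β n * ∑ s', (M.P h s (π h s) s').toReal *
            sumValue M (bonus H ι F) π n (h + 1) s' := by
        rw [Finset.mul_sum]
        refine Finset.sum_le_sum fun s' _ => ?_
        rw [mul_left_comm (width β n)]
        exact mul_le_mul_of_nonneg_left (ih (by omega) s') ENNReal.toReal_nonneg
      -- The excess splits into a model error, tested against the optimistic values, and the excess
      -- at the next step, averaged under the true kernel.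
      have h3 : Real.sign β * (Real.exp (β * M.r h s (π h s)) * ∑ s', P s' * W s' -
          expValue M β π (n + 1) h s) = Real.exp (β * M.r h s (π h s)) *
          ((∑ s', P s' * (Real.sign β * W s') -
            ∑ s', (M.P h s (π h s) s').toReal * (Real.sign β * W s')) +
          ∑ s', (M.P h s (π h s) s').toReal *
            (Real.sign β * (W s' - expValue M β π n (h + 1) s'))) := by
        simp only [expValue, mul_left_comm _ (Real.sign β), ← Finset.mul_sum, mul_sub,
          Finset.sum_sub_distrib]
        ring
      rw [h3, sumValue]
      have hb := bonus_nonneg (H := H) ι F h s (π h s)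
      calc _ ≤ Real.exp (β * M.r h s (π h s)) * (width β n * (bonus H ι F h s (π h s) +
            ∑ s', (M.P h s (π h s) s').toReal *
              sumValue M (bonus H ι F) π n (h + 1) s')) :=
            mul_le_mul_of_nonneg_left (by rw [mul_add]; exact add_le_add h1 h2)
              (Real.exp_pos _).le
        _ ≤ _ := by
            rw [← mul_assoc]
            push_cast
            exact mul_le_mul_of_nonneg_right (exp_mul_width_le hβ (Nat.cast_nonneg n) hr)
              (add_nonneg hb hB)
    -- At an unvisited pair the bonus is 1 and pays for the whole width of the range.
    · have h1 : (H : ℝ) - h = (n + 1 : ℕ) := by rw [← hn]; push_cast; ring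
      rw [h1, sumValue, bonus_of_visitCount_eq_zero ι (by omega) (by omega)]
      have h2 := (inRange_expValue M hβ π (n + 1) h hn.le s).1
      have h3 := mul_nonneg hw' hB
      calc _ ≤ width β (n + 1 : ℕ) := by rw [width]; linarith
        _ ≤ _ := by linarith

/-- The regret of ROVI in one episode. -/
theorem optValue_sub_value_le [Finite A] [Nonempty A] (hβ : β ≠ 0) (hF : Concentrated M ι F)
    (tie : History S A → TieBreak S A) (s : S) :
    optValue M β s - value M β (rovi H M.r β ι tie F) s ≤
      lipConst β H * sumValue M (bonus H ι F) (rovi H M.r β ι tie F) H 0 s := by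
  have hWr := inRange_roviW (M := M) (ι := ι) (F := F) (tie F) hβ le_rfl s
  have h1 : optValue M β s ≤ Real.log (roviW H M.r β ι (tie F) F H s) / β := by
    refine ciSup_le fun π => ?_
    rw [value_eq]
    exact (log_div_le_log_div_iff hβ (hWr.pos hβ)
      ((inRange_expValue M hβ π H 0 (by simp) s).pos hβ)).2
      (sign_mul_expValue_le_roviW (tie F) hβ hF π (zero_add H) s)
  rw [value_eq]
  refine (sub_le_sub_right h1 _).trans ?_
  exact width_div_le hβ hWr (inRange_expValue M hβ _ H 0 (by simp) s)
    (sign_mul_expValue_le_roviW (tie F) hβ hF _ (zero_add H) s)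
    (sign_mul_roviW_sub_le hβ hF tie (zero_add H) s)

end Optimism

/-! ## The potential of the visit counts -/

section Potential

variable {S A : Type*}

/-- The vanishing of `u` at late steps makes this valid for lists of any length; hence the bounds on
observed bonuses hold pointwise, also off the support of `rollout`. -/
theorem totalReward_eq_sum (u : ℕ → S → A → ℝ) (m h : ℕ) (l : List (S × A × S))
    (hu : ∀ i, h + m ≤ i → ∀ s a, u i s a = 0) :
    totalReward u h l =
      ∑ i ∈ Finset.range m, (l[i]?).elim 0 fun x => u (h + i) x.1 x.2.1 := by
  induction l generalizing h m with
  | nil => simp [totalReward]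
  | cons x l ih =>
    obtain ⟨s, a, s'⟩ := x
    cases m with
    | zero =>
      have h1 := ih 0 (h + 1) fun i hi => hu i (by omega)
      simp only [Finset.range_zero, Finset.sum_empty] at h1 ⊢
      rw [totalReward, h1, hu h (by omega), add_zero]
    | succ m =>
      rw [totalReward, ih m (h + 1) fun i hi => hu i (by omega), Finset.sum_range_succ']
      simp [add_comm, add_left_comm]

variable [Fintype S] [DecidableEq S] [DecidableEq A] {H : ℕ} (ι : ℝ) (F : History S A)

theorem totalReward_bonus (l : List (S × A × S)) : totalReward (bonus H ι F) 0 l =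
    ∑ i ∈ Finset.range H, (l[i]?).elim 0 fun x => bonus H ι F i x.1 x.2.1 := by
  rw [totalReward_eq_sum _ H]
  · simp
  · intro i hi s a
    rw [bonus, if_neg (by omega)]

theorem totalReward_bonus_nonneg (l : List (S × A × S)) :
    0 ≤ totalReward (bonus H ι F) 0 l := by
  rw [totalReward_bonus]
  refine Finset.sum_nonneg fun i _ => ?_
  rcases l[i]? with _ | x
  · exact le_rfl
  · exact bonus_nonneg ι F _ _ _

theorem totalReward_bonus_le (l : List (S × A × S)) : totalReward (bonus H ι F) 0 l ≤ H := by
  rw [totalReward_bonus]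
  refine (Finset.sum_le_card_nsmul _ _ 1 fun i _ => ?_).trans_eq (by simp)
  rcases l[i]? with _ | x
  · exact zero_le_one
  · exact bonus_le_one ι F _ _ _

/-- For `n ≥ 1`, `√(n+1) - √n = 1 / (√(n+1) + √n)` and `√(n+1) ≤ 2 √n`, whence the constant 3. -/
theorem inv_sqrt_max_le (n : ℕ) :
    1 / Real.sqrt (max (n : ℝ) 1) ≤ 3 * (Real.sqrt (n + 1 : ℕ) - Real.sqrt n) := by
  rcases Nat.eq_zero_or_pos n with rfl | hn
  · norm_num
  have hn1 : (1 : ℝ) ≤ n := by exact_mod_cast hn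
  rw [max_eq_left hn1]
  have h0 : 0 < Real.sqrt n := Real.sqrt_pos.2 (by linarith)
  have h1 : Real.sqrt n ^ 2 = n := Real.sq_sqrt (by linarith)
  have h2 : Real.sqrt (n + 1 : ℕ) ^ 2 = n + 1 := by
    rw [Real.sq_sqrt (Nat.cast_nonneg _)]; push_cast; ring
  have h3 : Real.sqrt (n + 1 : ℕ) ≤ 2 * Real.sqrt n := by
    refine Real.sqrt_le_iff.2 ⟨by linarith, ?_⟩
    rw [mul_pow, h1]
    push_cast
    linarith
  have h4 : Real.sqrt n ≤ Real.sqrt (n + 1 : ℕ) := Real.sqrt_le_sqrt (by push_cast; linarith)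
  rw [div_le_iff₀ h0]
  nlinarith

variable [Fintype A]

/-- The sum of the square roots of all visit counts. -/
noncomputable def potential (H : ℕ) (F : History S A) : ℝ :=
  ∑ h ∈ Finset.range H, ∑ x : S × A, Real.sqrt (visitCount F h x.1 x.2)

theorem totalReward_bonus_le_potential (e : Episode S A) :
    totalReward (bonus H ι F) 0 e.2 ≤ 3 * (1 + 2 * Real.sqrt (2 * Fintype.card S * ι)) *
      (potential H (e :: F) - potential H F) := by
  rw [totalReward_bonus, potential, potential, ← Finset.sum_sub_distrib, Finset.mul_sum]
  refine Finset.sum_le_sum fun i hi => ?_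
  set c := 1 + 2 * Real.sqrt (2 * Fintype.card S * ι) with hc
  have hc0 : 0 ≤ c := by positivity
  rw [← Finset.sum_sub_distrib]
  have hmono : ∀ x ∈ (Finset.univ : Finset (S × A)),
      0 ≤ Real.sqrt (visitCount (e :: F) i x.1 x.2) - Real.sqrt (visitCount F i x.1 x.2) :=
    fun x _ => sub_nonneg.2 (Real.sqrt_le_sqrt (by rw [visitCount_cons]; exact_mod_cast Nat.le_add_right _ _))
  rcases hx : e.2[i]? with _ | ⟨s, a, s'⟩
  · exact mul_nonneg (by positivity) (Finset.sum_nonneg hmono)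
  · have h1 := Finset.single_le_sum hmono (Finset.mem_univ (s, a))
    simp only [visitCount_cons e F i s a, hx, sum_hit_some, and_self, if_true] at h1
    simp only [Option.elim]
    calc bonus H ι F i s a ≤ c / Real.sqrt (max (visitCount F i s a : ℝ) 1) := by
          rw [bonus, if_pos (Finset.mem_range.1 hi)]
          exact min_le_right _ _
      _ = c * (1 / Real.sqrt (max (visitCount F i s a : ℝ) 1)) := by ring
      _ ≤ c * (3 * (Real.sqrt (visitCount F i s a + 1 : ℕ) -
            Real.sqrt (visitCount F i s a))) := by
          gcongr
          exact inv_sqrt_max_le _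
      _ = 3 * c * (Real.sqrt (visitCount F i s a + 1 : ℕ) -
            Real.sqrt (visitCount F i s a)) := by ring
      _ ≤ _ := by gcongr

/-- Cauchy–Schwarz over the state-action pairs at each step, whose counts sum to at most the number
of episodes. -/
theorem potential_le : potential H F ≤
    H * Real.sqrt (Fintype.card S * Fintype.card A * F.length) := by
  refine (Finset.sum_le_card_nsmul _ _ _ fun h _ => ?_).trans_eq
    (by rw [Finset.card_range, nsmul_eq_mul])
  refine Real.le_sqrt_of_sq_le ((sq_sum_le_card_mul_sum_sq).trans ?_)
  simp only [Real.sq_sqrt (Nat.cast_nonneg _), Finset.card_univ, Fintype.card_prod]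
  rw [← Nat.cast_sum]
  push_cast
  gcongr
  exact_mod_cast sum_visitCount_le_length F h

end Potential

/-! ## From the expected to the observed bonuses -/

section Drift

variable {S A : Type*} [Fintype S] [DecidableEq S] [DecidableEq A] {H : ℕ}
  (M : EpisodicMDP S A H) (ι : ℝ) (alg : Algorithm S A)

/-- The exponent of the supermartingale that compares expected and observed bonuses. -/
noncomputable def drift : History S A → ℝ
  | [] => 0
  | e :: F => sumValue M (bonus H ι F) (alg F) H 0 e.1 / (2 * H) -
      totalReward (bonus H ι F) 0 e.2 / H + drift F

theorem exp_neg_le_one_sub_half {y : ℝ} (h0 : 0 ≤ y) (h1 : y ≤ 1) : Real.exp (-y) ≤ 1 - y / 2 := by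
  have h := Real.add_one_le_exp y
  rw [Real.exp_neg]
  refine (inv_anti₀ (by linarith) h).trans ?_
  rw [inv_le_iff_one_le_mul₀ (by linarith)]
  nlinarith

/-- With `t ∈ [0, H]` the observed bonus sum and `B` its mean, `E exp (-t/H) ≤ 1 - B/(2H) ≤ exp
(-B/(2H))`. The first inequality replaces the exponential by an affine function of `t`, whose mean
is explicit. -/
theorem expect_exp_drift_le (hH : 1 ≤ H) (F : History S A) (s : S) :
    expect (rollout M (alg F) H 0 s)
      (fun e => ENNReal.ofReal (Real.exp (drift M ι alg ((s, e) :: F)))) ≤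
      ENNReal.ofReal (Real.exp (drift M ι alg F)) := by
  have hH' : (1 : ℝ) ≤ H := by exact_mod_cast hH
  set B := sumValue M (bonus H ι F) (alg F) H 0 s with hB
  set c := Real.exp (drift M ι alg F) * (Real.exp (B / (2 * H)) / (2 * H)) with hc
  have hc0 : 0 ≤ c := by positivity
  have h1 : ∀ e, ENNReal.ofReal (Real.exp (drift M ι alg ((s, e) :: F))) ≤
      ENNReal.ofReal c * ENNReal.ofReal (2 * H - totalReward (bonus H ι F) 0 e) := by
    intro e
    rw [← ENNReal.ofReal_mul hc0]
    refine ENNReal.ofReal_le_ofReal ?_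
    have h2 := exp_neg_le_one_sub_half
      (div_nonneg (totalReward_bonus_nonneg (H := H) ι F e) (by linarith : (0 : ℝ) ≤ H))
      ((div_le_one (by linarith)).2 (totalReward_bonus_le ι F e))
    have h3 : Real.exp (drift M ι alg ((s, e) :: F)) = Real.exp (drift M ι alg F) *
        Real.exp (B / (2 * H)) * Real.exp (-(totalReward (bonus H ι F) 0 e / H)) := by
      rw [← Real.exp_add, ← Real.exp_add, drift]
      congr 1
      simp only [← hB]
      ring
    rw [h3]
    refine (mul_le_mul_of_nonneg_left h2 (by positivity)).trans_eq ?_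
    rw [hc]
    field_simp
  refine (expect_mono h1).trans ?_
  rw [expect_const_mul, expect_rollout_sub M (alg F) (bonus_le_one ι F) H 0 s (by linarith),
    ← ENNReal.ofReal_mul hc0, ← hB]
  refine ENNReal.ofReal_le_ofReal ?_
  have h4 : c * (2 * H - B) = Real.exp (drift M ι alg F) *
      (Real.exp (B / (2 * H)) * (1 - B / (2 * H))) := by
    rw [hc]
    field_simp
  rw [h4]
  refine mul_le_of_le_one_right (Real.exp_pos _).le ?_
  calc Real.exp (B / (2 * H)) * (1 - B / (2 * H)) ≤
        Real.exp (B / (2 * H)) * Real.exp (-(B / (2 * H))) :=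
        mul_le_mul_of_nonneg_left (Real.one_sub_le_exp_neg _) (Real.exp_pos _).le
    _ = 1 := by rw [← Real.exp_add]; simp

/-- With probability at least `1 - δ / 2`, the drift is at most `log (2 / δ)`. -/
theorem toOuterMeasure_log_lt_drift_le (hH : 1 ≤ H) (init : History S A → PMF S) (K : ℕ)
    {δ : ℝ} (hδ : 0 < δ) :
    (historyLaw M init alg K).toOuterMeasure {F | Real.log (2 / δ) < drift M ι alg F} ≤
      ENNReal.ofReal (δ / 2) := by
  have h := ville_inequality (init := init) (expect_exp_drift_le M ι alg hH)
    (ENNReal.ofReal (2 / δ)) K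
  rw [drift, Real.exp_zero, ENNReal.ofReal_one, mul_comm] at h
  have h1 := ENNReal.le_inv_iff_mul_le.2 h
  rw [← ENNReal.ofReal_inv_of_pos (by positivity), inv_div] at h1
  refine le_trans (MeasureTheory.measure_mono fun F hF => ?_) h1
  exact ⟨F, List.suffix_refl F, ENNReal.ofReal_le_ofReal
    ((Real.log_le_iff_le_exp (by positivity)).1 (le_of_lt hF))⟩

end Drift

/-! ## The regret bound -/

section Regret

variable {S A : Type*} [Fintype S] [Nonempty A] {H : ℕ} {M : EpisodicMDP S A H} {β ι : ℝ}

theorem regret_le_length_mul (hβ : β ≠ 0) (alg : Algorithm S A) (F : History S A) :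
    regret M β alg F ≤ F.length * H := by
  induction F with
  | nil => simp [regret]
  | cons e F ih =>
    have h1 : optValue M β e.1 ≤ H := ciSup_le fun π => (value_mem_Icc M hβ π e.1).2
    have h2 := (value_mem_Icc M hβ (alg F) e.1).1
    rw [regret]
    push_cast [List.length_cons]
    linarith

variable [Nonempty S] [Fintype A]

/-- Each episode costs at most `H ≤ L_H`, and `K ≤ 4 ℓ` gives `K ≤ 2 √(K ℓ)`. -/
theorem regret_bound_of_few_episodes (hβ : β ≠ 0) (hH : 1 ≤ H) (alg : Algorithm S A)
    {F : History S A} {K : ℕ} (hlen : F.length = K) {ℓ : ℝ} (hℓ : 1 ≤ ℓ)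
    (hK : (K : ℝ) ≤ 4 * ℓ) :
    regret M β alg F ≤ 26 * lipConst β H * H *
      Real.sqrt ((Fintype.card S : ℝ) ^ 2 * Fintype.card A * K * ℓ) := by
  have hL := le_lipConst hβ (H : ℝ)
  have hS : (1 : ℝ) ≤ Fintype.card S := by exact_mod_cast Fintype.card_pos (α := S)
  have hA : (1 : ℝ) ≤ Fintype.card A := by exact_mod_cast Fintype.card_pos (α := A)
  have hH' : (1 : ℝ) ≤ H := by exact_mod_cast hH
  set X := Real.sqrt ((Fintype.card S : ℝ) ^ 2 * Fintype.card A * K * ℓ) with hX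
  have h1 : (K : ℝ) ≤ 2 * X := by
    have h2 : Real.sqrt (K * ℓ) ≤ X := by
      refine Real.sqrt_le_sqrt ?_
      calc (K : ℝ) * ℓ = 1 ^ 2 * 1 * K * ℓ := by ring
        _ ≤ _ := by gcongr
    have h3 : (K : ℝ) / 2 ≤ Real.sqrt (K * ℓ) := by
      refine Real.le_sqrt_of_sq_le ?_
      nlinarith [Nat.cast_nonneg (α := ℝ) K]
    linarith
  have hX0 : 0 ≤ X := Real.sqrt_nonneg _
  calc regret M β alg F ≤ K * H := hlen ▸ regret_le_length_mul hβ alg F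
    _ ≤ (2 * X) * lipConst β H := by gcongr
    _ = 2 * lipConst β H * 1 * X := by ring
    _ ≤ 26 * lipConst β H * H * X := by
        have : 0 ≤ lipConst β H := by linarith
        gcongr
        norm_num

variable [DecidableEq S] [DecidableEq A]

/-- An expected bonus sum `B` is `2 H` times the increment of `drift` plus twice the observed sum,
and the latter is bounded by an increment of `potential`; both telescope. -/
theorem regret_le_drift_add_potential (hH : 1 ≤ H) (hβ : β ≠ 0)
    (tie : History S A → TieBreak S A) {F : History S A}
    (hF : ∀ F', F' <:+ F → Concentrated M ι F') :
    regret M β (rovi H M.r β ι tie) F ≤ lipConst β H *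
      (2 * H * drift M ι (rovi H M.r β ι tie) F +
        6 * (1 + 2 * Real.sqrt (2 * Fintype.card S * ι)) * potential H F) := by
  have hH' : (1 : ℝ) ≤ H := by exact_mod_cast hH
  have hL : 0 ≤ lipConst β H := (Nat.cast_nonneg _).trans (le_lipConst hβ H)
  induction F with
  | nil => simp [regret, drift, potential, visitCount, transCount]
  | cons e F ih =>
    have h1 := ih fun F' hF' => hF F' (hF'.trans (List.suffix_cons e F))
    have h2 := optValue_sub_value_le hβ (hF F (List.suffix_cons e F)) tie e.1
    have h3 := totalReward_bonus_le_potential (H := H) ι F e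
    rw [regret, drift]
    refine (add_le_add h2 h1).trans ?_
    rw [← mul_add]
    refine mul_le_mul_of_nonneg_left ?_ hL
    set B := sumValue M (bonus H ι F) (rovi H M.r β ι tie F) H 0 e.1
    set t := totalReward (bonus H ι F) 0 e.2
    have h4 : 2 * (H : ℝ) * (B / (2 * H) - t / H + drift M ι (rovi H M.r β ι tie) F) =
        B - 2 * t + 2 * H * drift M ι (rovi H M.r β ι tie) F := by
      field_simp
    rw [h4]
    linarith

theorem regret_bound_of_good (hH : 1 ≤ H) (hβ : β ≠ 0) (tie : History S A → TieBreak S A)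
    {F : History S A} {K : ℕ} (hlen : F.length = K)
    (hF : ∀ F', F' <:+ F → Concentrated M ι F') {ℓ : ℝ} (hℓ : 1 ≤ ℓ) (hι : ι ≤ ℓ) (hK : ℓ ≤ K)
    (hd : drift M ι (rovi H M.r β ι tie) F ≤ ℓ) :
    regret M β (rovi H M.r β ι tie) F ≤ 26 * lipConst β H * H *
      Real.sqrt ((Fintype.card S : ℝ) ^ 2 * Fintype.card A * K * ℓ) := by
  have hL : 0 ≤ lipConst β H := (Nat.cast_nonneg _).trans (le_lipConst hβ H)
  have hS : (1 : ℝ) ≤ Fintype.card S := by exact_mod_cast Fintype.card_pos (α := S)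
  have hA : (1 : ℝ) ≤ Fintype.card A := by exact_mod_cast Fintype.card_pos (α := A)
  set X := Real.sqrt ((Fintype.card S : ℝ) ^ 2 * Fintype.card A * K * ℓ) with hX
  have h1 : ℓ ≤ X := by
    refine Real.le_sqrt_of_sq_le ?_
    calc ℓ ^ 2 = 1 ^ 2 * 1 * ℓ * ℓ := by ring
      _ ≤ _ := by gcongr
  have h2 : 1 + 2 * Real.sqrt (2 * Fintype.card S * ι) ≤
      4 * Real.sqrt (Fintype.card S * ℓ) := by
    have h3 : 1 ≤ Real.sqrt (Fintype.card S * ℓ) :=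
      Real.one_le_sqrt.2 (one_le_mul_of_one_le_of_one_le hS hℓ)
    have h4 : Real.sqrt (2 * Fintype.card S * ι) ≤
        3 / 2 * Real.sqrt (Fintype.card S * ℓ) := by
      refine Real.sqrt_le_iff.2 ⟨by positivity, ?_⟩
      rw [mul_pow, Real.sq_sqrt (by positivity)]
      have : (Fintype.card S : ℝ) * ι ≤ Fintype.card S * ℓ := by gcongr
      nlinarith [mul_nonneg (zero_le_one.trans hS) (zero_le_one.trans hℓ)]
    linarith
  have h5 : (1 + 2 * Real.sqrt (2 * Fintype.card S * ι)) * potential H F ≤ 4 * (H * X) := by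
    calc _ ≤ 4 * Real.sqrt (Fintype.card S * ℓ) *
          (H * Real.sqrt (Fintype.card S * Fintype.card A * K)) :=
          mul_le_mul h2 (hlen ▸ potential_le F)
            (Finset.sum_nonneg fun _ _ => Finset.sum_nonneg fun _ _ => Real.sqrt_nonneg _)
            (by positivity)
      _ = 4 * (H * (Real.sqrt (Fintype.card S * ℓ) *
          Real.sqrt (Fintype.card S * Fintype.card A * K))) := by ring
      _ = 4 * (H * X) := by
          rw [← Real.sqrt_mul (by positivity), hX]
          congr 3
          ring
  refine (regret_le_drift_add_potential hH hβ tie hF).trans ?_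
  have h6 : (H : ℝ) * drift M ι (rovi H M.r β ι tie) F ≤ H * X := by
    gcongr
    exact hd.trans h1
  -- The constant is `26 = 2 + 6 * 4`: drift term plus bonus term.
  calc _ ≤ lipConst β H * (26 * (H * X)) := mul_le_mul_of_nonneg_left (by linarith) hL
    _ = _ := by ring

end Regret

end RiskRL

/-! ### Assembly of the main theorem -/

theorem mainTheorem2 :
    ∃ C : ℝ, 0 < C ∧
      ∀ (S A : Type*) [Fintype S] [Fintype A] [Nonempty S] [Nonempty A]
        [DecidableEq S] [DecidableEq A]
        (H K : ℕ) (_ : 1 ≤ H) (_ : 1 ≤ K)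
        (M : RiskRL.EpisodicMDP S A H) (init : RiskRL.History S A → PMF S)
        (tie : RiskRL.History S A → RiskRL.TieBreak S A)
        (β : ℝ) (_ : β ≠ 0) (δ : ℝ) (_ : 0 < δ) (_ : δ < 1)
        (ι : ℝ)
        (_ : Real.log ((Fintype.card S : ℝ) * Fintype.card A * (K * H) / δ) ≤ ι)
        (_ : ι ≤ Real.log (4 * (Fintype.card S : ℝ) * Fintype.card A * (K * H) / δ)),
        RiskRL.rodiMB H M.r β ι tie = RiskRL.rovi H M.r β ι tie ∧
        ∀ alg ∈ ({RiskRL.rodiMB H M.r β ι tie, RiskRL.rovi H M.r β ι tie} :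
            Set (RiskRL.Algorithm S A)),
          ENNReal.ofReal (1 - δ) ≤ (RiskRL.historyLaw M init alg K).toOuterMeasure
            {F | RiskRL.regret M β alg F ≤
              C * RiskRL.lipConst β H * H *
                Real.sqrt ((Fintype.card S : ℝ) ^ 2 * Fintype.card A * K *
                  Real.log (4 * (Fintype.card S : ℝ) * Fintype.card A * (K * H) / δ))} := by
  refine ⟨26, by norm_num, ?_⟩
  intro S A _ _ _ _ _ _ H K hH hK M init tie β hβ δ hδ0 hδ1 ι hι1 hι2
  have heq := RiskRL.rodiMB_eq_rovi H M.r ι hβ tie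
  refine ⟨heq, fun alg halg => ?_⟩
  obtain rfl : alg = RiskRL.rovi H M.r β ι tie := by
    rcases halg with rfl | rfl
    · exact heq
    · rfl
  have hS : (1 : ℝ) ≤ Fintype.card S := by exact_mod_cast Fintype.card_pos (α := S)
  have hA : (1 : ℝ) ≤ Fintype.card A := by exact_mod_cast Fintype.card_pos (α := A)
  have hH' : (1 : ℝ) ≤ H := by exact_mod_cast hH
  have hK' : (1 : ℝ) ≤ K := by exact_mod_cast hK
  have hT : 4 ≤ 4 * (Fintype.card S : ℝ) * Fintype.card A * (K * H) := by
    calc (4 : ℝ) = 4 * 1 * 1 * (1 * 1) := by norm_num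
      _ ≤ _ := by gcongr
  -- The factor 4 inside the logarithm exceeds `e`, which gives this bound.
  have hℓ : 1 ≤ Real.log (4 * (Fintype.card S : ℝ) * Fintype.card A * (K * H) / δ) := by
    rw [Real.le_log_iff_exp_le (by positivity), le_div_iff₀ hδ0]
    nlinarith [Real.exp_one_lt_d9, Real.exp_pos 1]
  have hlog : Real.log (2 / δ) ≤
      Real.log (4 * (Fintype.card S : ℝ) * Fintype.card A * (K * H) / δ) := by
    refine Real.log_le_log (by positivity) ?_
    gcongr
    linarith
  set ℓ := Real.log (4 * (Fintype.card S : ℝ) * Fintype.card A * (K * H) / δ)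
  refine RiskRL.ofReal_one_sub_le_toOuterMeasure _ hδ0.le ?_
  -- Beyond this threshold `K ≥ 4`, as the union bound requires, and `ℓ ≤ K`, so that the term `H ℓ`
  -- from the drift is of lower order.
  by_cases hsmall : (K : ℝ) ≤ 4 * ℓ
  · refine (RiskRL.toOuterMeasure_historyLaw_mono (Y := ∅) fun F hF hlen => ?_).trans (by simp)
    exact hF (RiskRL.regret_bound_of_few_episodes hβ hH _ hlen hℓ hsmall)
  push Not at hsmall
  have hK4 : 4 ≤ K := by
    have : (4 : ℝ) ≤ K := by linarith
    exact_mod_cast this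
  rw [← add_halves δ, ENNReal.ofReal_add (by positivity) (by positivity)]
  refine (RiskRL.toOuterMeasure_historyLaw_mono fun F hF hlen => ?_).trans
    ((MeasureTheory.measure_union_le _ _).trans (add_le_add
      (RiskRL.toOuterMeasure_not_concentrated_le_half hH hK4 hδ0 hδ1 hι1 init _)
      (RiskRL.toOuterMeasure_log_lt_drift_le M ι _ hH init K hδ0)))
  by_contra hgood
  rw [Set.mem_union, not_or] at hgood
  exact hF (RiskRL.regret_bound_of_good hH hβ tie hlen (not_not.1 hgood.1) hℓ hι2
    (by linarith) ((not_lt.1 hgood.2).trans hlog))
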